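/- Let $n\ge 0$ and $1\le p\le d$ be integers, $w\in\mathbb{R}^d$ and $\sigma>0$. Let $x\sim\mathcal N(0,I_d)$ and $\epsilon\sim\mathcal N(0,1)$ be independent, and put $y=x^\top w+\sigma\epsilon$. Let $(x_1,y_1),\dots,(x_n,y_n)$ be i.i.d. copies of $(x,y)$, independent of $(x,y)$; let $\mathbf X\in\mathbb{R}^{n\times d}$ be the matrix with rows $x_i^\top$ and $\mathbf Y=(y_1,\dots,y_n)^\top$. Let $T$ be a uniformly random subset of $\{1,\dots,d\}$ of cardinality $p$, independent of all the data. Let $\hat w\in\mathbb{R}^d$ be the least-norm least-squares estimator on the selected features: its coordinates in $T$ form the vector $\mathbf X_T^{+}\mathbf Y$, where $\mathbf X_T$ is the $n\times p$ submatrix of $\mathbf X$ formed by the columns with index in $T$ and $^+$ is the Moore–Penrose inverse, and its coordinates outside $T$ are $0$. If $p\le n-2$ or $p\ge n+2$, then the risk $\mathbb E[(y-x^\top\hat w)^2]$ (expectation over the test point, the training sample and $T$) is finite, and $$ \mathbb E[(y-x^\top\hat w)^2]= \begin{cases} \left(\left(1-\frac pd\right)\|w\|^2+\sigma^2\right)\left(1+\frac{p}{n-p-1}\right)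 & \text{if } p\le n-2,\\[4pt] \|w\|^2\left(1-\frac nd\left(2-\frac{d-n-1}{p-n-1}\right)\right)+\sigma^2\left(1+\frac{n}{p-n-1}\right) & \text{if } p\ge n+2. \end{cases} $$ -/

import Mathlib

/-- The four Penrose conditions: `B` is the Moore–Penrose inverse of the real matrix `A`. -/
structure IsMoorePenrose {m k : Type*} [Fintype m] [Fintype k]
    (A : Matrix m k ℝ) (B : Matrix k m ℝ) : Prop where
  mul_mul_left : A * B * A = A
  mul_mul_right : B * A * B = B
  symm_left : (A * B).transpose = A * B
  symm_right : (B * A).transpose = B * A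

theorem IsMoorePenrose.unique {m k : Type*} [Fintype m] [Fintype k]
    {A : Matrix m k ℝ} {B C : Matrix k m ℝ} (hB : IsMoorePenrose A B)
    (hC : IsMoorePenrose A C) : B = C := by
  have h1 : A * B = A * C := by
    calc A * B = (A * C * A) * B := by rw [hC.mul_mul_left]
      _ = (A * C) * (A * B) := by simp only [Matrix.mul_assoc]
      _ = (A * C).transpose * (A * B).transpose := by rw [hB.symm_left, hC.symm_left]
      _ = ((A * B * A) * C).transpose := by
          rw [← Matrix.transpose_mul]; simp only [Matrix.mul_assoc]
      _ = A * C := by rw [hB.mul_mul_left, hC.symm_left]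
  have h2 : B * A = C * A := by
    calc B * A = B * (A * C * A) := by rw [hC.mul_mul_left]
      _ = (B * A) * (C * A) := by simp only [Matrix.mul_assoc]
      _ = (B * A).transpose * (C * A).transpose := by rw [hB.symm_right, hC.symm_right]
      _ = (C * (A * B * A)).transpose := by
          rw [← Matrix.transpose_mul]; simp only [Matrix.mul_assoc]
      _ = C * A := by rw [hB.mul_mul_left, hC.symm_right]
  calc B = B * A * B := hB.mul_mul_right.symm
    _ = C * (A * B) := by rw [h2, Matrix.mul_assoc]
    _ = C * A * C := by rw [h1, Matrix.mul_assoc]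
    _ = C := hC.mul_mul_right

theorem exists_isMoorePenrose {m k : Type*} [Fintype m] [Fintype k]
    (A : Matrix m k ℝ) : ∃ B : Matrix k m ℝ, IsMoorePenrose A B := by
  classical
  obtain ⟨R, h1, h2, h3, h4⟩ : ∃ R : Matrix k k ℝ,
      (A.transpose * A) * R * (A.transpose * A) = A.transpose * A ∧
      R * (A.transpose * A) * R = R ∧ R.transpose = R ∧
      R * (A.transpose * A) = (A.transpose * A) * R := by
    have hQ : (A.transpose * A).IsHermitian := by
      simpa using Matrix.isHermitian_conjTranspose_mul_self A
    generalize A.transpose * A = Q at hQ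
    have hs := hQ.spectral_theorem
    set φ := Unitary.conjStarAlgAut ℝ (Matrix k k ℝ) hQ.eigenvectorUnitary
    generalize hD : (RCLike.ofReal ∘ hQ.eigenvalues : k → ℝ) = D at hs
    refine ⟨φ (Matrix.diagonal fun i => (D i)⁻¹), ?_, ?_, ?_, ?_⟩
    · rw [hs, ← map_mul, ← map_mul, Matrix.diagonal_mul_diagonal, Matrix.diagonal_mul_diagonal]
      simp only [mul_inv_mul_cancel]
    · rw [hs, ← map_mul, ← map_mul, Matrix.diagonal_mul_diagonal, Matrix.diagonal_mul_diagonal]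
      congr 2
      ext i
      by_cases h : D i = 0 <;> simp [h]
    · rw [← Matrix.conjTranspose_eq_transpose_of_trivial, ← Matrix.star_eq_conjTranspose,
        ← map_star, Matrix.star_eq_conjTranspose, Matrix.diagonal_conjTranspose]
      congr 2
    · rw [hs, ← map_mul, ← map_mul, Matrix.diagonal_mul_diagonal, Matrix.diagonal_mul_diagonal]
      simp only [mul_comm]
  refine ⟨R * A.transpose, ?_, ?_, ?_, ?_⟩
  · have h : A.conjTranspose * A * (R * (A.transpose * A) - 1) = 0 := by
      rw [Matrix.conjTranspose_eq_transpose_of_trivial, Matrix.mul_sub, Matrix.mul_one,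
        ← Matrix.mul_assoc, h1, sub_self]
    rw [Matrix.conjTranspose_mul_self_mul_eq_zero, Matrix.mul_sub, Matrix.mul_one,
      sub_eq_zero] at h
    simpa only [Matrix.mul_assoc] using h
  · calc R * A.transpose * A * (R * A.transpose)
        = (R * (A.transpose * A) * R) * A.transpose := by simp only [Matrix.mul_assoc]
      _ = R * A.transpose := by rw [h2]
  · simp only [Matrix.transpose_mul, Matrix.transpose_transpose, h3, Matrix.mul_assoc]
  · rw [Matrix.mul_assoc, Matrix.transpose_mul, h3, Matrix.transpose_mul,
      Matrix.transpose_transpose, h4]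

/-- The Moore–Penrose inverse of a real matrix. -/
noncomputable def pinv {m k : Type*} [Fintype m] [Fintype k] (A : Matrix m k ℝ) :
    Matrix k m ℝ :=
  (exists_isMoorePenrose A).choose

theorem isMoorePenrose_pinv {m k : Type*} [Fintype m] [Fintype k] (A : Matrix m k ℝ) :
    IsMoorePenrose A (pinv A) :=
  (exists_isMoorePenrose A).choose_spec

/-- The `n × |S|` submatrix, with columns indexed by `S`, of the design matrix whose `i`-th row
is the vector `X i`. -/
def selectedDesign {n d : ℕ} (S : Finset (Fin d)) (X : Fin n → EuclideanSpace ℝ (Fin d)) :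
    Matrix (Fin n) S ℝ :=
  Matrix.of fun i j => X i j

/-- The least-norm least-squares estimator using only the features in `S`: its coordinates in `S`
are those of the pseudo-inverse of the selected design matrix applied to the responses `y`,
and its coordinates outside `S` are zero. -/
noncomputable def minNormEstimator {n d : ℕ} (S : Finset (Fin d))
    (X : Fin n → EuclideanSpace ℝ (Fin d)) (y : Fin n → ℝ) : EuclideanSpace ℝ (Fin d) :=
  WithLp.toLp 2 fun j =>
    if h : j ∈ S then (pinv (selectedDesign S X)).mulVec y ⟨j, h⟩ else 0

/-! Fix the selected set `S`. The response splits as `y = x_S · w_S + z`, where `z` collects the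
unselected features and the noise. It is centred with variance `τ = ‖w_{Sᶜ}‖² + σ²`, and it is
independent of `x_S` because it uses disjoint Gaussian coordinates. The training data thus become `Y
= A w_S + z` with `A` a Gaussian matrix independent of the noise vector. Integrating the test point
and then the training noise gives risk `τ + E‖(1 - A⁺A) w_S‖² + τ E‖A⁺‖²` (Frobenius norm); this is
`lintegral_prediction_error`.

Two Gaussian expectations remain, for `A` with `m` rows in dimension `k ≥ m + 2`. First, `1 - A⁺A`
projects onto the complement of the row space. By rotation invariance the mean squared length of a
projected vector depends only on its norm, and the trace of the projection is `k - m`, so the factor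
is `1 - m/k` (`lintegral_norm_sq_gramResidual`). Second, `‖A⁺‖²` is the trace of `(AAᵀ)⁻¹`, whose
diagonal entries are inverse squared distances from a row to the span of the others. Each such
distance is the norm of a standard Gaussian in dimension `k - m + 1`, and the inverse square has
mean `1/(k - m - 1)` (`lintegral_gram_inv_apply_self`). The gap of two makes that dimension at least
three, which is what keeps the mean finite. Tall matrices reduce to wide ones by transposition, with
`A⁺A = 1` almost surely.

For fixed `S` the risk is affine in `∑ j ∈ S, w j ^ 2`, whose average over `p`-subsets is
`(p/d)‖w‖²`. Extended nonnegative integrals are used until the end, so Tonelli needs no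
integrability, and finiteness comes with the value. -/

open MeasureTheory ProbabilityTheory Matrix
open scoped ENNReal InnerProductSpace

/-! ### Inverse second moment of the norm of a Gaussian vector -/

theorem integral_exp_neg_mul_sq_gaussianReal {t : ℝ} (ht : 0 ≤ t) :
    ∫ x, Real.exp (-t * x ^ 2) ∂gaussianReal 0 1 = (√(1 + 2 * t))⁻¹ := by
  rw [integral_gaussianReal_eq_integral_smul one_ne_zero]
  have h : ∀ x : ℝ, gaussianPDFReal 0 1 x • Real.exp (-t * x ^ 2) =
      (√(2 * Real.pi))⁻¹ * Real.exp (-(1 / 2 + t) * x ^ 2) := by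
    intro x
    rw [gaussianPDFReal_def, smul_eq_mul, mul_assoc, ← Real.exp_add]
    simp only [NNReal.coe_one, mul_one, sub_zero]
    congr 2
    ring
  simp_rw [h]
  rw [integral_const_mul, integral_gaussian, ← Real.sqrt_inv, ← Real.sqrt_mul (by positivity),
    ← Real.sqrt_inv]
  congr 1
  have : (1 + 2 * t) ≠ 0 := by positivity
  have : (1 / 2 + t) ≠ 0 := by positivity
  field_simp

section
variable {E : Type*} [NormedAddCommGroup E] [InnerProductSpace ℝ E] [FiniteDimensional ℝ E]
  [MeasurableSpace E] [BorelSpace E]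

theorem lintegral_exp_neg_mul_norm_sq_stdGaussian {t : ℝ} (ht : 0 ≤ t) :
    ∫⁻ x, ENNReal.ofReal (Real.exp (-t * ‖x‖ ^ 2)) ∂stdGaussian E =
      ENNReal.ofReal ((√(1 + 2 * t))⁻¹ ^ Module.finrank ℝ E) := by
  rw [← ofReal_integral_eq_lintegral_ofReal]
  · congr 1
    rw [stdGaussian, integral_map (Measurable.aemeasurable (by fun_prop))
      (Measurable.aestronglyMeasurable (by fun_prop)),
      ← integral_exp_neg_mul_sq_gaussianReal ht]
    have h : ∀ x : Fin (Module.finrank ℝ E) → ℝ,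
        Real.exp (-t * ‖∑ i, x i • stdOrthonormalBasis ℝ E i‖ ^ 2) =
          ∏ i, Real.exp (-t * x i ^ 2) := by
      intro x
      rw [← Real.exp_sum, ← Finset.mul_sum, ← (stdOrthonormalBasis ℝ E).sum_sq_norm_inner_right]
      simp [(stdOrthonormalBasis ℝ E).orthonormal.inner_right_fintype]
    simp_rw [h]
    rw [integral_fintype_prod_eq_pow (fun x : ℝ => Real.exp (-t * x ^ 2)), Fintype.card_fin]
  · refine Integrable.of_bound (C := 1) (Measurable.aestronglyMeasurable (by fun_prop))
      (Filter.Eventually.of_forall fun x => ?_)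
    rw [Real.norm_eq_abs, Real.abs_exp, Real.exp_le_one_iff]
    nlinarith [sq_nonneg ‖x‖]
  · exact Filter.Eventually.of_forall fun x => (Real.exp_pos _).le

/-- Characteristic functions agree: for `t ∈ W`, pairing `t` with the projection of `x` is the same
as pairing it with `x`. -/
theorem stdGaussian_map_orthogonalProjectionOnto (W : Submodule ℝ E) :
    (stdGaussian E).map W.orthogonalProjectionOnto = stdGaussian W := by
  have : IsProbabilityMeasure ((stdGaussian E).map W.orthogonalProjectionOnto) :=
    Measure.isProbabilityMeasure_map (by fun_prop)
  apply Measure.ext_of_charFun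
  ext t
  rw [charFun_stdGaussian, charFun_apply, integral_map (by fun_prop)
    (Measurable.aestronglyMeasurable (by fun_prop))]
  simp_rw [Submodule.inner_orthogonalProjectionOnto_eq_of_mem_right]
  rw [← charFun_apply, charFun_stdGaussian]
  simp

theorem ENNReal.inv_ofReal_eq_lintegral_exp {u : ℝ} (hu : 0 ≤ u) :
    (ENNReal.ofReal u)⁻¹ = ∫⁻ t in Set.Ioi (0 : ℝ), ENNReal.ofReal (Real.exp (-t * u)) := by
  rcases hu.eq_or_lt with rfl | hu
  -- At `u = 0` both sides are `∞`, so no exceptional set is needed later.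
  · simp
  · rw [← ofReal_integral_eq_lintegral_ofReal]
    · have h := integral_exp_mul_Ioi (neg_lt_zero.mpr hu) 0
      simp_rw [neg_mul, mul_comm _ u]
      simp_rw [neg_mul] at h
      rw [h, ← ENNReal.ofReal_inv_of_pos hu]
      simp
    · have := integrableOn_exp_mul_Ioi (neg_lt_zero.mpr hu) 0
      exact this.congr (ae_of_all _ fun t => by ring_nf)
    · exact Filter.Eventually.of_forall fun x => (Real.exp_pos _).le

theorem lintegral_inv_sqrt_pow {n : ℕ} (hn : 3 ≤ n) :
    ∫⁻ t in Set.Ioi (0 : ℝ), ENNReal.ofReal ((√(1 + 2 * t))⁻¹ ^ n) =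
      ENNReal.ofReal ((n : ℝ) - 2)⁻¹ := by
  have hn' : (3 : ℝ) ≤ n := by exact_mod_cast hn
  have hrw : ∀ t ∈ Set.Ioi (0 : ℝ), (√(1 + 2 * t))⁻¹ ^ n = (1 + 2 * t) ^ (-(n : ℝ) / 2) := by
    intro t ht
    have ht' : 0 < 1 + 2 * t := by have := Set.mem_Ioi.mp ht; positivity
    rw [Real.sqrt_eq_rpow, ← Real.rpow_neg ht'.le, ← Real.rpow_natCast, ← Real.rpow_mul ht'.le]
    congr 1
    ring
  -- Explicit antiderivative. Since `n ≥ 3`, its exponent `1 - n/2` is negative and it vanishes at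
  -- infinity, so only the value at `0` contributes.
  have hderiv : ∀ t ∈ Set.Ioi (0 : ℝ), HasDerivAt
      (fun t : ℝ => -((n : ℝ) - 2)⁻¹ * (1 + 2 * t) ^ (1 - (n : ℝ) / 2))
      ((1 + 2 * t) ^ (-(n : ℝ) / 2)) t := by
    intro t ht
    have ht' : 0 < 1 + 2 * t := by have := Set.mem_Ioi.mp ht; positivity
    have h1 : HasDerivAt (fun t : ℝ => 1 + 2 * t) 2 t := by
      simpa using ((hasDerivAt_id t).const_mul 2).const_add 1
    have h2 := (h1.rpow_const (p := 1 - (n : ℝ) / 2) (Or.inl ht'.ne')).const_mul (-((n : ℝ) - 2)⁻¹)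
    refine h2.congr_deriv ?_
    have : (n : ℝ) - 2 ≠ 0 := by linarith
    rw [show 1 - (n : ℝ) / 2 - 1 = -(n : ℝ) / 2 by ring]
    field_simp
    ring
  have hcont : ContinuousWithinAt
      (fun t : ℝ => -((n : ℝ) - 2)⁻¹ * (1 + 2 * t) ^ (1 - (n : ℝ) / 2)) (Set.Ici 0) 0 := by
    apply ContinuousAt.continuousWithinAt
    apply ContinuousAt.const_mul
    exact ContinuousAt.rpow_const (by fun_prop) (Or.inl (by norm_num))
  have hlim : Filter.Tendsto
      (fun t : ℝ => -((n : ℝ) - 2)⁻¹ * (1 + 2 * t) ^ (1 - (n : ℝ) / 2)) Filter.atTop (nhds 0) := by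
    have h1 : Filter.Tendsto (fun t : ℝ => 1 + 2 * t) Filter.atTop Filter.atTop :=
      Filter.tendsto_atTop_add_const_left _ _
        (Filter.tendsto_id.const_mul_atTop (by norm_num : (0 : ℝ) < 2))
    have h2 := (tendsto_rpow_neg_atTop (y := (n : ℝ) / 2 - 1) (by linarith)).comp h1
    have h3 := h2.const_mul (-((n : ℝ) - 2)⁻¹)
    simpa [Function.comp_def] using h3
  have hnonneg : ∀ t ∈ Set.Ioi (0 : ℝ), 0 ≤ (1 + 2 * t) ^ (-(n : ℝ) / 2) := by
    intro t ht
    have := Set.mem_Ioi.mp ht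
    positivity
  have hint := integrableOn_Ioi_deriv_of_nonneg hcont hderiv hnonneg hlim
  rw [setLIntegral_congr_fun measurableSet_Ioi (fun t ht => by rw [hrw t ht]),
    ← ofReal_integral_eq_lintegral_ofReal hint
      ((ae_restrict_iff' measurableSet_Ioi).mpr (Filter.Eventually.of_forall hnonneg)),
    integral_Ioi_of_hasDerivAt_of_tendsto hcont hderiv hint hlim]
  simp

/-- Write `1/‖x‖²` as the integral of `exp (-t‖x‖²)` over `t > 0`, exchange the integrals, and
integrate the Gaussian Laplace transform `(1 + 2t)^(-N/2)`, where `N` is the dimension. -/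
theorem lintegral_inv_norm_sq_stdGaussian (h : 3 ≤ Module.finrank ℝ E) :
    ∫⁻ x, (ENNReal.ofReal (‖x‖ ^ 2))⁻¹ ∂stdGaussian E =
      ENNReal.ofReal ((Module.finrank ℝ E : ℝ) - 2)⁻¹ := by
  simp_rw [fun x : E => ENNReal.inv_ofReal_eq_lintegral_exp (sq_nonneg ‖x‖)]
  rw [lintegral_lintegral_swap (Measurable.aemeasurable (by fun_prop)),
    ← lintegral_inv_sqrt_pow h]
  refine setLIntegral_congr_fun measurableSet_Ioi fun t ht => ?_
  exact lintegral_exp_neg_mul_norm_sq_stdGaussian (Set.mem_Ioi.mp ht).le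

theorem lintegral_inv_norm_sq_orthogonalProjectionOnto (W : Submodule ℝ E)
    (h : 3 ≤ Module.finrank ℝ W) :
    ∫⁻ x, (ENNReal.ofReal (‖W.orthogonalProjectionOnto x‖ ^ 2))⁻¹ ∂stdGaussian E =
      ENNReal.ofReal ((Module.finrank ℝ W : ℝ) - 2)⁻¹ := by
  rw [← lintegral_inv_norm_sq_stdGaussian h, ← stdGaussian_map_orthogonalProjectionOnto W,
    lintegral_map (by fun_prop) (by fun_prop)]

/-- In `ℝ≥0∞` the inverse of `0` is `∞`, so the finite inverse moment already forbids a zero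
projection on a set of positive measure. -/
theorem ae_orthogonalProjectionOnto_ne_zero (W : Submodule ℝ E) (h : 3 ≤ Module.finrank ℝ W) :
    ∀ᵐ x ∂stdGaussian E, W.orthogonalProjectionOnto x ≠ 0 := by
  have h1 := ae_lt_top (μ := stdGaussian E)
    (f := fun x => (ENNReal.ofReal (‖W.orthogonalProjectionOnto x‖ ^ 2))⁻¹) (by fun_prop)
    (by rw [lintegral_inv_norm_sq_orthogonalProjectionOnto W h]; exact ENNReal.ofReal_ne_top)
  filter_upwards [h1] with x hx h0
  simp [h0] at hx

end

/-! ### Measurability of inverses, and isolating one of several i.i.d. vectors -/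

section
variable {κ Ω : Type*} [Fintype κ] [DecidableEq κ] [MeasurableSpace Ω]

theorem measurable_matrix_det {f : Ω → Matrix κ κ ℝ} (hf : ∀ i j, Measurable fun ω => f ω i j) :
    Measurable fun ω => (f ω).det := by
  simp_rw [Matrix.det_apply]
  refine Finset.measurable_sum _ fun s _ => ?_
  exact Measurable.const_smul (Finset.measurable_prod _ fun i _ => hf _ _) _

theorem measurable_matrix_inv_apply {f : Ω → Matrix κ κ ℝ}
    (hf : ∀ i j, Measurable fun ω => f ω i j) (i j : κ) :
    Measurable fun ω => (f ω)⁻¹ i j := by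
  simp_rw [Matrix.inv_def, Ring.inverse_eq_inv', Matrix.smul_apply, smul_eq_mul,
    Matrix.adjugate_apply]
  refine (measurable_matrix_det hf).inv.mul (measurable_matrix_det fun a b => ?_)
  by_cases h : a = j
  · subst h; simp
  · simpa [Matrix.updateRow_apply, h] using hf a b
end

/-- The distinguished vector is the second factor, so iterated integration freezes the other vectors
and integrates over this one first. -/
theorem measurePreserving_insertNth {α : Type*} [MeasurableSpace α] (μ : Measure α) [SigmaFinite μ]
    {k : ℕ} (i : Fin (k + 1)) :
    MeasurePreserving (fun q : (Fin k → α) × α => (i.insertNth q.2 q.1 : Fin (k + 1) → α))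
      ((Measure.pi fun _ : Fin k => μ).prod μ) (Measure.pi fun _ : Fin (k + 1) => μ) :=
  (measurePreserving_piFinSuccAbove (fun _ : Fin (k + 1) => μ) i).symm.comp
    Measure.measurePreserving_swap

/-! ### Inverse Gram matrices of Gaussian vectors -/

section
variable {E : Type*} [NormedAddCommGroup E] [InnerProductSpace ℝ E]
  {κ : Type*} [Fintype κ] [DecidableEq κ]

theorem gram_det_comp_equiv {κ' : Type*} [Fintype κ'] [DecidableEq κ'] (e : κ' ≃ κ) (v : κ → E) :
    (gram ℝ (v ∘ e)).det = (gram ℝ v).det :=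
  Matrix.det_submatrix_equiv_self e (gram ℝ v)

theorem gram_inv_comp_equiv {κ' : Type*} [Fintype κ'] [DecidableEq κ'] (e : κ' ≃ κ) (v : κ → E)
    (i j : κ') : (gram ℝ (v ∘ e))⁻¹ i j = (gram ℝ v)⁻¹ (e i) (e j) := by
  have : gram ℝ (v ∘ e) = (gram ℝ v).submatrix e e := rfl
  rw [this, Matrix.inv_submatrix_equiv]
  rfl

end

theorem measurable_gram_apply {E κ : Type*} [NormedAddCommGroup E]
    [InnerProductSpace ℝ E] [FiniteDimensional ℝ E] [MeasurableSpace E] [BorelSpace E] (i j : κ) : Measurable fun v : κ → E => gram ℝ v i j := by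
  simp only [gram_apply]
  fun_prop

section
variable {E : Type*} [NormedAddCommGroup E] [InnerProductSpace ℝ E] [FiniteDimensional ℝ E]
  {κ : Type*} [Fintype κ] [DecidableEq κ]

/-- Row `i` of the inverse gives the dual vector `c`, with `⟪c, v k⟫ = δ_ik`. It lies in `Vᗮ`, so
projecting its expansion kills every term but the `i`-th, and pairing with `v i` gives the formula.
The equation `hV` lets `V` be presented as the span of a family from which `v i` is absent. -/
theorem gram_inv_apply_self {v : κ → E} (h : (gram ℝ v).det ≠ 0) (i : κ) {V : Submodule ℝ E}
    (hV : V = Submodule.span ℝ (v '' {i}ᶜ)) :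
    (gram ℝ v)⁻¹ i i = (‖Vᗮ.orthogonalProjectionOnto (v i)‖ ^ 2)⁻¹ := by
  have hmul : (gram ℝ v)⁻¹ * gram ℝ v = 1 := Matrix.nonsing_inv_mul _ (isUnit_iff_ne_zero.mpr h)
  set c : E := ∑ j, (gram ℝ v)⁻¹ i j • v j with hc
  have hcv : ∀ k, ⟪c, v k⟫_ℝ = (1 : Matrix κ κ ℝ) i k := by
    intro k
    rw [← hmul, hc, sum_inner, Matrix.mul_apply]
    simp [real_inner_smul_left, gram_apply]
  have hcV : c ∈ Vᗮ := by
    rw [hV, Submodule.mem_orthogonal']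
    intro u hu
    induction hu using Submodule.span_induction with
    | mem x hx =>
      obtain ⟨j, hj, rfl⟩ := hx
      rw [hcv, Matrix.one_apply_ne (Ne.symm hj)]
    | zero => simp
    | add x y _ _ hx hy => rw [inner_add_right, hx, hy, add_zero]
    | smul a x _ hx => rw [inner_smul_right, hx, mul_zero]
  have hproj : ∀ j, j ≠ i → Vᗮ.starProjection (v j) = 0 := by
    intro j hj
    have : v j ∈ V := hV ▸ Submodule.subset_span ⟨j, hj, rfl⟩
    rw [Submodule.starProjection_apply, Submodule.orthogonalProjectionOnto_eq_zero_iff.mpr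
      (Submodule.le_orthogonal_orthogonal V this), Submodule.coe_zero]
  have hcP : c = (gram ℝ v)⁻¹ i i • Vᗮ.starProjection (v i) := by
    rw [← Submodule.starProjection_eq_self_iff.mpr hcV, hc, map_sum]
    rw [Finset.sum_eq_single i]
    · simp
    · intro j _ hj
      rw [map_smul, hproj j hj, smul_zero]
    · simp
  have h1 : (gram ℝ v)⁻¹ i i * ‖Vᗮ.orthogonalProjectionOnto (v i)‖ ^ 2 = 1 := by
    have := hcv i
    rw [Matrix.one_apply_eq, hcP, real_inner_smul_left,
      Submodule.starProjection_apply] at this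
    rw [← this, ← real_inner_self_eq_norm_sq,
      Submodule.inner_orthogonalProjectionOnto_eq_of_mem_left]
  exact eq_inv_of_mul_eq_one_left h1

variable [MeasurableSpace E] [BorelSpace E]

theorem measurable_gram_inv_apply (i j : κ) : Measurable fun v : κ → E => (gram ℝ v)⁻¹ i j :=
  measurable_matrix_inv_apply measurable_gram_apply i j

theorem measurableSet_det_gram_ne_zero : MeasurableSet {v : κ → E | (gram ℝ v).det ≠ 0} :=
  (measurable_matrix_det measurable_gram_apply) (measurableSet_singleton 0).compl

/-- Add the vectors one at a time: the complement of the span of the earlier ones has dimension at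
least three, so the new vector almost surely has a nonzero component there. -/
theorem ae_det_gram_ne_zero_fin (k : ℕ) (hk : k + 2 ≤ Module.finrank ℝ E) :
    ∀ᵐ v ∂Measure.pi (fun _ : Fin k => stdGaussian E), (gram ℝ v).det ≠ 0 := by
  induction k with
  | zero => exact Filter.Eventually.of_forall fun v => by simp
  | succ k ih =>
    have hmp := measurePreserving_insertNth (stdGaussian E) (0 : Fin (k + 1))
    rw [← hmp.map_eq, ae_map_iff hmp.measurable.aemeasurable measurableSet_det_gram_ne_zero]
    refine (Measure.ae_prod_iff_ae_ae (hmp.measurable measurableSet_det_gram_ne_zero)).mpr ?_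
    filter_upwards [ih (by omega)] with v hv
    set V := Submodule.span ℝ (Set.range v) with hV
    have hdim : Module.finrank ℝ V ≤ k := by
      simpa [hV, Set.finrank] using finrank_range_le_card (R := ℝ) v
    have h3 : 3 ≤ Module.finrank ℝ Vᗮ := by
      have := Submodule.finrank_add_finrank_orthogonal V
      omega
    filter_upwards [ae_orthogonalProjectionOnto_ne_zero Vᗮ h3] with x hx
    rw [det_gram_ne_zero_iff_linearIndependent] at hv ⊢
    rw [Fin.insertNth_zero']
    refine LinearIndependent.finCons hv fun hxV => hx ?_
    exact Submodule.orthogonalProjectionOnto_eq_zero_iff.mpr (Submodule.le_orthogonal_orthogonal V hxV)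

/-- With the other vectors frozen, the entry is the inverse squared norm of a Gaussian projected
onto a fixed subspace. Its expectation depends only on the dimension of that subspace, which is
almost surely constant. -/
theorem lintegral_gram_inv_apply_self_fin (k : ℕ) (hk : k + 2 ≤ Module.finrank ℝ E) (i : Fin k) :
    ∫⁻ v, ENNReal.ofReal ((gram ℝ v)⁻¹ i i) ∂Measure.pi (fun _ : Fin k => stdGaussian E) =
      ENNReal.ofReal ((Module.finrank ℝ E : ℝ) - k - 1)⁻¹ := by
  obtain _ | k := k
  · exact i.elim0
  have hcomp := measurePreserving_insertNth (stdGaussian E) i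
  have hmeas : Measurable fun v : Fin (k + 1) → E => ENNReal.ofReal ((gram ℝ v)⁻¹ i i) :=
    (measurable_gram_inv_apply i i).ennreal_ofReal
  have hae := ae_det_gram_ne_zero_fin (E := E) (k + 1) hk
  rw [← hcomp.map_eq, ae_map_iff hcomp.measurable.aemeasurable measurableSet_det_gram_ne_zero]
    at hae
  rw [← hcomp.lintegral_comp hmeas]
  rw [lintegral_prod (fun q : (Fin k → E) × E => ENNReal.ofReal
    ((gram ℝ (i.insertNth q.2 q.1 : Fin (k + 1) → E))⁻¹ i i))
    (hmeas.comp hcomp.measurable).aemeasurable]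
  have hae' := Measure.ae_ae_of_ae_prod hae
  have hconst : ∀ᵐ v ∂Measure.pi (fun _ : Fin k => stdGaussian E),
      ∫⁻ x, ENNReal.ofReal ((gram ℝ (i.insertNth x v : Fin (k + 1) → E))⁻¹ i i) ∂stdGaussian E =
      ENNReal.ofReal ((Module.finrank ℝ E : ℝ) - (k + 1 : ℕ) - 1)⁻¹ := by
    filter_upwards [hae', ae_det_gram_ne_zero_fin (E := E) k (by omega)] with v hv hv0
    set V := Submodule.span ℝ (Set.range v) with hV
    rw [det_gram_ne_zero_iff_linearIndependent] at hv0
    have hdim : Module.finrank ℝ V = k := by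
      simpa using finrank_span_eq_card hv0
    have hadd := Submodule.finrank_add_finrank_orthogonal V
    have h3 : 3 ≤ Module.finrank ℝ Vᗮ := by omega
    -- Only `k` of the `k + 1` vectors span `V`, which turns the `2` of the inverse moment into a
    -- `1`.
    have hcast : (Module.finrank ℝ Vᗮ : ℝ) - 2 = (Module.finrank ℝ E : ℝ) - (k + 1 : ℕ) - 1 := by
      rw [← hadd, hdim]; push_cast; ring
    rw [← hcast, ← lintegral_inv_norm_sq_orthogonalProjectionOnto Vᗮ h3]
    refine lintegral_congr_ae ?_
    filter_upwards [hv, ae_orthogonalProjectionOnto_ne_zero Vᗮ h3] with x hx hx0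
    rw [gram_inv_apply_self hx i (V := V), ENNReal.ofReal_inv_of_pos]
    · simp
    · rw [Fin.insertNth_apply_same]
      positivity
    · rw [← Fin.range_succAbove, ← Set.range_comp, hV]
      congr 2
      ext j
      simp 
  rw [lintegral_congr_ae hconst]
  simp

theorem ae_det_gram_ne_zero (hk : Fintype.card κ + 2 ≤ Module.finrank ℝ E) :
    ∀ᵐ v ∂Measure.pi (fun _ : κ => stdGaussian E), (gram ℝ v).det ≠ 0 := by
  have e := (Fintype.equivFin κ).symm
  have hmp := measurePreserving_piCongrLeft (fun _ : κ => stdGaussian E) e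
  rw [← hmp.map_eq, ae_map_iff hmp.measurable.aemeasurable measurableSet_det_gram_ne_zero]
  filter_upwards [ae_det_gram_ne_zero_fin (E := E) _ hk] with v hv
  rw [← gram_det_comp_equiv e]
  convert hv
  ext j
  simp [MeasurableEquiv.coe_piCongrLeft]

theorem lintegral_gram_inv_apply_self (hk : Fintype.card κ + 2 ≤ Module.finrank ℝ E) (i : κ) :
    ∫⁻ v, ENNReal.ofReal ((gram ℝ v)⁻¹ i i) ∂Measure.pi (fun _ : κ => stdGaussian E) =
      ENNReal.ofReal ((Module.finrank ℝ E : ℝ) - Fintype.card κ - 1)⁻¹ := by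
  have e := (Fintype.equivFin κ).symm
  have hmp := measurePreserving_piCongrLeft (fun _ : κ => stdGaussian E) e
  have hmeas : Measurable fun v : κ → E => ENNReal.ofReal ((gram ℝ v)⁻¹ i i) :=
    (measurable_gram_inv_apply i i).ennreal_ofReal
  rw [← hmp.lintegral_comp hmeas,
    ← lintegral_gram_inv_apply_self_fin (E := E) _ hk (e.symm i)]
  refine lintegral_congr fun v => ?_
  have : v = (MeasurableEquiv.piCongrLeft (fun _ => E) e v) ∘ e := by
    ext j
    simp [MeasurableEquiv.coe_piCongrLeft]
  conv_rhs => rw [this, gram_inv_comp_equiv]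
  simp

end

/-! ### Mean squared residual of a projection onto a Gaussian span -/

section
variable {E : Type*} [NormedAddCommGroup E] [InnerProductSpace ℝ E]
  {κ : Type*} [Fintype κ] [DecidableEq κ]

/-- The residual of the least-squares projection of `w` on the span of the vectors `v i`. -/
noncomputable def gramResidual (v : κ → E) (w : E) : E :=
  w - ∑ i, (∑ j, (gram ℝ v)⁻¹ i j * ⟪v j, w⟫_ℝ) • v i

theorem gramResidual_smul (v : κ → E) (a : ℝ) (w : E) :
    gramResidual v (a • w) = a • gramResidual v w := by
  simp only [gramResidual, smul_sub, Finset.smul_sum, smul_smul, inner_smul_right, Finset.mul_sum]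
  congr 1
  refine Finset.sum_congr rfl fun i _ => ?_
  congr 1
  exact Finset.sum_congr rfl fun j _ => by ring

theorem gramResidual_map (U : E ≃ₗᵢ[ℝ] E) (v : κ → E) (w : E) :
    gramResidual (fun i => U (v i)) (U w) = U (gramResidual v w) := by
  have hg : gram ℝ (fun i => U (v i)) = gram ℝ v := by
    ext i j
    simp [gram_apply]
  simp [gramResidual, hg, map_sum]

/-- The normal equations `G c = b` make the squared norm of the fitted vector equal to its inner
product with `w`; both are `b ⬝ᵥ c`. -/
theorem norm_sq_gramResidual {v : κ → E} (h : (gram ℝ v).det ≠ 0) (w : E) :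
    ‖gramResidual v w‖ ^ 2 =
      ‖w‖ ^ 2 - ∑ i, ∑ j, (gram ℝ v)⁻¹ i j * (⟪v i, w⟫_ℝ * ⟪w, v j⟫_ℝ) := by
  set b : κ → ℝ := fun j => ⟪v j, w⟫_ℝ with hb
  set c : κ → ℝ := (gram ℝ v)⁻¹ *ᵥ b with hc
  have hGc : gram ℝ v *ᵥ c = b := by
    rw [hc, Matrix.mulVec_mulVec, Matrix.mul_nonsing_inv _ (isUnit_iff_ne_zero.mpr h),
      Matrix.one_mulVec]
  have h1 : gramResidual v w = w - ∑ i, c i • v i := rfl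
  have h2 : ⟪w, ∑ i, c i • v i⟫_ℝ = b ⬝ᵥ c := by
    simp [inner_sum, inner_smul_right, dotProduct, hb, real_inner_comm, mul_comm]
  have h3 : ‖∑ i, c i • v i‖ ^ 2 = b ⬝ᵥ c := by
    rw [← real_inner_self_eq_norm_sq, ← star_dotProduct_gram_mulVec, hGc, star_trivial,
      dotProduct_comm]
  have h4 : ∑ i, ∑ j, (gram ℝ v)⁻¹ i j * (⟪v i, w⟫_ℝ * ⟪w, v j⟫_ℝ) = b ⬝ᵥ c := by
    simp only [dotProduct, hc, Matrix.mulVec, Finset.mul_sum, hb]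
    refine Finset.sum_congr rfl fun i _ => Finset.sum_congr rfl fun j _ => ?_
    rw [real_inner_comm (v j) w]
    ring
  rw [h1, norm_sub_sq_real, h2, h3, h4]
  ring

/-- This is the trace of the complementary projection; Parseval turns the subtracted term into the
trace of `G⁻¹ G`. -/
theorem sum_norm_sq_gramResidual {ι : Type*} [Fintype ι] {v : κ → E} (h : (gram ℝ v).det ≠ 0)
    (e : OrthonormalBasis ι ℝ E) :
    ∑ a, ‖gramResidual v (e a)‖ ^ 2 = (Fintype.card ι : ℝ) - Fintype.card κ := by
  simp_rw [norm_sq_gramResidual h, Finset.sum_sub_distrib]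
  congr 1
  · simp
  · have : ∑ a, ∑ i, ∑ j, (gram ℝ v)⁻¹ i j * (⟪v i, e a⟫_ℝ * ⟪e a, v j⟫_ℝ) =
        ∑ i, ∑ j, (gram ℝ v)⁻¹ i j * gram ℝ v j i := by
      rw [Finset.sum_comm]
      refine Finset.sum_congr rfl fun i _ => ?_
      rw [Finset.sum_comm]
      refine Finset.sum_congr rfl fun j _ => ?_
      rw [← Finset.mul_sum, e.sum_inner_mul_inner, gram_apply, real_inner_comm]
    rw [this]
    have htr : ((gram ℝ v)⁻¹ * gram ℝ v).trace = Fintype.card κ := by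
      rw [Matrix.nonsing_inv_mul _ (isUnit_iff_ne_zero.mpr h), Matrix.trace_one]
    rw [← htr]
    simp [Matrix.trace, Matrix.mul_apply]

variable [FiniteDimensional ℝ E] [MeasurableSpace E] [BorelSpace E]

theorem measurable_gramResidual (w : E) : Measurable fun v : κ → E => gramResidual v w := by
  unfold gramResidual
  refine measurable_const.sub (Finset.measurable_sum _ fun i _ => ?_)
  refine Measurable.smul (Finset.measurable_sum _ fun j _ => ?_) (measurable_pi_apply i)
  exact (measurable_gram_inv_apply i j).mul (by fun_prop)

/-- A reflection carries `w` to `w'`; it preserves the Gaussian law and commutes with taking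
residuals. -/
theorem lintegral_norm_sq_gramResidual_congr {w w' : E} (hw : ‖w‖ = ‖w'‖) :
    ∫⁻ v, ENNReal.ofReal (‖gramResidual v w‖ ^ 2) ∂Measure.pi (fun _ : κ => stdGaussian E) =
      ∫⁻ v, ENNReal.ofReal (‖gramResidual v w'‖ ^ 2) ∂Measure.pi (fun _ : κ => stdGaussian E) := by
  set U : E ≃ₗᵢ[ℝ] E := (ℝ ∙ (w - w'))ᗮ.reflection with hU
  have hUw : U w = w' := Submodule.reflection_sub hw
  have hmp := measurePreserving_pi (fun _ : κ => stdGaussian E) (fun _ : κ => stdGaussian E)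
    (f := fun _ => U) fun _ => ⟨U.continuous.measurable, stdGaussian_map U⟩
  rw [← hmp.lintegral_comp ((measurable_gramResidual w').norm.pow_const 2).ennreal_ofReal]
  refine lintegral_congr fun v => ?_
  rw [← hUw, gramResidual_map, U.norm_map]

/-- All vectors of an orthonormal basis have the same expected residual by rotation invariance, and
these sum to the trace. Homogeneity then handles a general `w`. -/
theorem lintegral_norm_sq_gramResidual (hk : Fintype.card κ + 2 ≤ Module.finrank ℝ E) (w : E) :
    ∫⁻ v, ENNReal.ofReal (‖gramResidual v w‖ ^ 2) ∂Measure.pi (fun _ : κ => stdGaussian E) =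
      ENNReal.ofReal ((1 - (Fintype.card κ : ℝ) / Module.finrank ℝ E) * ‖w‖ ^ 2) := by
  set m := Module.finrank ℝ E with hm
  have hm0 : (0 : ℝ) < m := by exact_mod_cast (by omega : 0 < m)
  let e := stdOrthonormalBasis ℝ E
  let a₀ : Fin m := ⟨0, by omega⟩
  set r : E → ℝ≥0∞ := fun w =>
    ∫⁻ v, ENNReal.ofReal (‖gramResidual v w‖ ^ 2) ∂Measure.pi (fun _ : κ => stdGaussian E) with hr
  have hsum : (m : ℝ≥0∞) * r (e a₀) = ENNReal.ofReal ((m : ℝ) - Fintype.card κ) := by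
    have h1 : ∀ a, r (e a) = r (e a₀) := fun a =>
      lintegral_norm_sq_gramResidual_congr (by simp)
    calc (m : ℝ≥0∞) * r (e a₀) = ∑ a : Fin m, r (e a) := by simp [h1]
      _ = ∫⁻ v, ∑ a : Fin m, ENNReal.ofReal (‖gramResidual v (e a)‖ ^ 2)
            ∂Measure.pi (fun _ : κ => stdGaussian E) := by
          rw [lintegral_finsetSum]
          exact fun a _ => ((measurable_gramResidual (e a)).norm.pow_const 2).ennreal_ofReal
      _ = ∫⁻ v, ENNReal.ofReal ((m : ℝ) - Fintype.card κ)
            ∂Measure.pi (fun _ : κ => stdGaussian E) := by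
          refine lintegral_congr_ae ?_
          filter_upwards [ae_det_gram_ne_zero (E := E) hk] with v hv
          rw [← ENNReal.ofReal_sum_of_nonneg fun a _ => sq_nonneg _,
            sum_norm_sq_gramResidual hv e, Fintype.card_fin]
      _ = _ := by simp
  have hr0 : r (e a₀) = ENNReal.ofReal (1 - (Fintype.card κ : ℝ) / m) := by
    have h2 : (m : ℝ≥0∞) * ENNReal.ofReal (1 - (Fintype.card κ : ℝ) / m) =
        ENNReal.ofReal ((m : ℝ) - Fintype.card κ) := by
      rw [← ENNReal.ofReal_natCast, ← ENNReal.ofReal_mul hm0.le]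
      congr 1
      field_simp
    rw [← h2] at hsum
    exact (ENNReal.mul_right_inj (by exact_mod_cast (by omega : m ≠ 0))
      (ENNReal.natCast_ne_top m)).mp hsum
  have hw : r w = r (‖w‖ • e a₀) :=
    lintegral_norm_sq_gramResidual_congr (by simp [norm_smul])
  change r w = _
  rw [hw, mul_comm, ENNReal.ofReal_mul (sq_nonneg _), ← hr0, hr]
  dsimp only
  rw [← lintegral_const_mul _ ((measurable_gramResidual (e a₀)).norm.pow_const 2).ennreal_ofReal]
  refine lintegral_congr fun v => ?_
  rw [gramResidual_smul, norm_smul, mul_pow, norm_norm, ENNReal.ofReal_mul (sq_nonneg _)]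

end

/-! ### Pseudo-inverses of matrices of full row rank -/

theorem gram_toLp {m k : Type*} [Fintype k] (A : m → k → ℝ) :
    gram ℝ (fun i => (WithLp.toLp 2 (A i) : EuclideanSpace ℝ k)) =
      Matrix.of A * (Matrix.of A)ᵀ := by
  ext i j
  simp [gram_apply, Matrix.mul_apply, PiLp.inner_apply, mul_comm]

section
variable {m k : Type*} [Fintype m] [Fintype k]

theorem pinv_transpose (A : Matrix m k ℝ) : pinv Aᵀ = (pinv A)ᵀ := by
  refine (isMoorePenrose_pinv Aᵀ).unique ?_
  have h := isMoorePenrose_pinv A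
  refine ⟨?_, ?_, ?_, ?_⟩
  · rw [← Matrix.transpose_mul, ← Matrix.transpose_mul, ← Matrix.mul_assoc, h.mul_mul_left]
  · rw [← Matrix.transpose_mul, ← Matrix.transpose_mul, ← Matrix.mul_assoc, h.mul_mul_right]
  · rw [← Matrix.transpose_mul, h.symm_right, h.symm_right]
  · rw [← Matrix.transpose_mul, h.symm_left, h.symm_left]

variable [DecidableEq m]

theorem pinv_eq_of_det_ne_zero {A : Matrix m k ℝ} (h : (A * Aᵀ).det ≠ 0) :
    pinv A = Aᵀ * (A * Aᵀ)⁻¹ := by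
  have hinv : A * Aᵀ * (A * Aᵀ)⁻¹ = 1 := Matrix.mul_nonsing_inv _ (isUnit_iff_ne_zero.mpr h)
  have hone : A * (Aᵀ * (A * Aᵀ)⁻¹) = 1 := by rw [← Matrix.mul_assoc, hinv]
  refine (isMoorePenrose_pinv A).unique ⟨?_, ?_, ?_, ?_⟩
  · rw [hone, Matrix.one_mul]
  · rw [Matrix.mul_assoc, hone, Matrix.mul_one]
  · rw [hone, Matrix.transpose_one]
  · simp only [Matrix.transpose_mul, Matrix.transpose_nonsing_inv, Matrix.transpose_transpose,
      Matrix.mul_assoc]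

theorem mul_pinv_of_det_ne_zero {A : Matrix m k ℝ} (h : (A * Aᵀ).det ≠ 0) : A * pinv A = 1 := by
  rw [pinv_eq_of_det_ne_zero h, ← Matrix.mul_assoc,
    Matrix.mul_nonsing_inv _ (isUnit_iff_ne_zero.mpr h)]

/-- The squared Frobenius norm is the trace of `(A⁺)ᵀ A⁺`, and this product collapses to `(AAᵀ)⁻¹`.
-/
theorem sum_sq_pinv {A : Matrix m k ℝ} (h : (A * Aᵀ).det ≠ 0) :
    ∑ a, ∑ i, pinv A a i ^ 2 = ∑ i, (A * Aᵀ)⁻¹ i i := by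
  have h1 : ((pinv A)ᵀ * pinv A) = (A * Aᵀ)⁻¹ := by
    rw [pinv_eq_of_det_ne_zero h]
    simp only [Matrix.transpose_mul, Matrix.transpose_nonsing_inv, Matrix.transpose_transpose]
    rw [Matrix.mul_assoc, ← Matrix.mul_assoc A,
      Matrix.mul_nonsing_inv _ (isUnit_iff_ne_zero.mpr h), Matrix.mul_one]
  rw [Finset.sum_comm, ← h1]
  simp [Matrix.mul_apply, pow_two]

theorem sum_sq_sub_pinv_mul {A : m → k → ℝ}
    (h : (Matrix.of A * (Matrix.of A)ᵀ).det ≠ 0) (u : k → ℝ) :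
    ∑ a, (u a - ((pinv (Matrix.of A) * Matrix.of A) *ᵥ u) a) ^ 2 =
      ‖gramResidual (fun i => (WithLp.toLp 2 (A i) : EuclideanSpace ℝ k)) (WithLp.toLp 2 u)‖ ^ 2 := by
  rw [EuclideanSpace.real_norm_sq_eq]
  refine Finset.sum_congr rfl fun a _ => ?_
  congr 1
  rw [pinv_eq_of_det_ne_zero h, gramResidual, gram_toLp]
  simp only [PiLp.sub_apply, WithLp.ofLp_sum, Finset.sum_apply, PiLp.smul_apply, smul_eq_mul]
  congr 1
  rw [← Matrix.mulVec_mulVec, ← Matrix.mulVec_mulVec]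
  simp only [Matrix.mulVec, dotProduct, Matrix.transpose_apply, Matrix.of_apply]
  refine Finset.sum_congr rfl fun i _ => ?_
  rw [mul_comm]
  congr 1
  refine Finset.sum_congr rfl fun j _ => ?_
  simp [PiLp.inner_apply, mul_comm]

end

/-! ### Gaussian matrices: wide case, then tall case by transposition -/

section
variable (m k : Type*) [Fintype m] [Fintype k]

/-- The law of an `m × k` matrix with independent standard normal entries. -/
noncomputable abbrev gaussianMatrix : Measure (m → k → ℝ) :=
  Measure.pi fun _ => Measure.pi fun _ => gaussianReal 0 1

theorem measurePreserving_toLp_gaussian :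
    MeasurePreserving (WithLp.toLp 2 : (k → ℝ) → EuclideanSpace ℝ k)
      (Measure.pi fun _ => gaussianReal 0 1) (stdGaussian (EuclideanSpace ℝ k)) :=
  ⟨by fun_prop, map_pi_eq_stdGaussian⟩

theorem measurePreserving_rows_gaussianMatrix :
    MeasurePreserving (fun (A : m → k → ℝ) i => (WithLp.toLp 2 (A i) : EuclideanSpace ℝ k))
      (gaussianMatrix m k) (Measure.pi fun _ : m => stdGaussian (EuclideanSpace ℝ k)) :=
  measurePreserving_pi _ _ fun _ => measurePreserving_toLp_gaussian k

theorem measurePreserving_curry_gaussian :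
    MeasurePreserving (MeasurableEquiv.curry m k ℝ)
      (Measure.pi fun _ : m × k => gaussianReal 0 1) (gaussianMatrix m k) := by
  refine ⟨(MeasurableEquiv.curry m k ℝ).measurable, ?_⟩
  have := Measure.infinitePi_map_curry (fun (_ : m) (_ : k) => gaussianReal 0 1)
  simpa only [Measure.infinitePi_eq_pi] using this

theorem measurePreserving_transpose_gaussianMatrix :
    MeasurePreserving (fun (A : m → k → ℝ) j i => A i j) (gaussianMatrix m k)
      (gaussianMatrix k m) := by
  have h1 := (measurePreserving_curry_gaussian m k).symm
  have h2 := measurePreserving_piCongrLeft (fun _ : k × m => gaussianReal 0 1) (Equiv.prodComm m k)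
  have h3 := (measurePreserving_curry_gaussian k m).comp (h2.comp h1)
  convert h3 using 1
  ext A j i
  have := MeasurableEquiv.piCongrLeft_apply_apply (β := fun _ => ℝ) (Equiv.prodComm m k)
    ((MeasurableEquiv.curry m k ℝ).symm A) (i, j)
  exact this.symm

variable {m k} [DecidableEq m]

theorem ae_det_gaussianMatrix_ne_zero (h : Fintype.card m + 2 ≤ Fintype.card k) :
    ∀ᵐ A ∂gaussianMatrix m k, (Matrix.of A * (Matrix.of A)ᵀ).det ≠ 0 := by
  have := ae_det_gram_ne_zero (E := EuclideanSpace ℝ k) (κ := m) (by simpa using h)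
  rw [← (measurePreserving_rows_gaussianMatrix m k).map_eq,
    ae_map_iff (measurePreserving_rows_gaussianMatrix m k).measurable.aemeasurable
      measurableSet_det_gram_ne_zero] at this
  filter_upwards [this] with A hA
  rwa [gram_toLp] at hA

/-- `pinv` is obtained by choice, so measurability is read off the explicit formula with which it
agrees almost everywhere. -/
theorem aemeasurable_pinv_gaussianMatrix (h : Fintype.card m + 2 ≤ Fintype.card k) (a : k) (i : m) :
    AEMeasurable (fun A => pinv (Matrix.of A) a i) (gaussianMatrix m k) := by
  refine ⟨fun A => ((Matrix.of A)ᵀ * (Matrix.of A * (Matrix.of A)ᵀ)⁻¹) a i, ?_, ?_⟩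
  · simp only [Matrix.mul_apply, Matrix.transpose_apply, Matrix.of_apply]
    refine Finset.measurable_sum _ fun j _ => ?_
    refine Measurable.mul (by fun_prop) (measurable_matrix_inv_apply (fun i j => ?_) _ _)
    simp only [Matrix.mul_apply, Matrix.transpose_apply, Matrix.of_apply]
    fun_prop
  · filter_upwards [ae_det_gaussianMatrix_ne_zero h] with A hA
    rw [pinv_eq_of_det_ne_zero hA]

theorem lintegral_sum_sq_pinv (h : Fintype.card m + 2 ≤ Fintype.card k) :
    ∫⁻ A, ENNReal.ofReal (∑ a, ∑ i, pinv (Matrix.of A) a i ^ 2) ∂gaussianMatrix m k =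
      ENNReal.ofReal ((Fintype.card m : ℝ) / ((Fintype.card k : ℝ) - Fintype.card m - 1)) := by
  have hmp := measurePreserving_rows_gaussianMatrix m k
  have h1 : ∀ᵐ A ∂gaussianMatrix m k,
      ENNReal.ofReal (∑ a, ∑ i, pinv (Matrix.of A) a i ^ 2) = ∑ i, ENNReal.ofReal
        ((gram ℝ fun i => (WithLp.toLp 2 (A i) : EuclideanSpace ℝ k))⁻¹ i i) := by
    filter_upwards [ae_det_gaussianMatrix_ne_zero h] with A hA
    rw [sum_sq_pinv hA, ← gram_toLp, ENNReal.ofReal_sum_of_nonneg]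
    intro i _
    rw [← gram_toLp] at hA
    rw [gram_inv_apply_self hA i rfl]
    positivity
  rw [lintegral_congr_ae h1, lintegral_finsetSum]
  · have h2 : ∀ i : m, ∫⁻ A, ENNReal.ofReal
        ((gram ℝ fun i => (WithLp.toLp 2 (A i) : EuclideanSpace ℝ k))⁻¹ i i) ∂gaussianMatrix m k =
        ENNReal.ofReal ((Fintype.card k : ℝ) - Fintype.card m - 1)⁻¹ := by
      intro i
      rw [hmp.lintegral_comp (measurable_gram_inv_apply i i).ennreal_ofReal,
        lintegral_gram_inv_apply_self (by simpa using h)]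
      simp
    simp_rw [h2]
    rw [Finset.sum_const, Finset.card_univ, nsmul_eq_mul, ← ENNReal.ofReal_natCast,
      ← ENNReal.ofReal_mul (Nat.cast_nonneg _), div_eq_mul_inv]
  · exact fun i _ => ((measurable_gram_inv_apply i i).comp hmp.measurable).ennreal_ofReal

theorem lintegral_sum_sq_sub_pinv_mul (h : Fintype.card m + 2 ≤ Fintype.card k) (u : k → ℝ) :
    ∫⁻ A, ENNReal.ofReal (∑ a, (u a - ((pinv (Matrix.of A) * Matrix.of A) *ᵥ u) a) ^ 2)
        ∂gaussianMatrix m k =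
      ENNReal.ofReal ((1 - (Fintype.card m : ℝ) / Fintype.card k) * ∑ a, u a ^ 2) := by
  have hmp := measurePreserving_rows_gaussianMatrix m k
  have h1 := lintegral_norm_sq_gramResidual (E := EuclideanSpace ℝ k) (κ := m) (by simpa using h)
    (WithLp.toLp 2 u)
  rw [← hmp.lintegral_comp ((measurable_gramResidual _).norm.pow_const 2).ennreal_ofReal] at h1
  simp only [finrank_euclideanSpace, EuclideanSpace.real_norm_sq_eq (WithLp.toLp 2 u)] at h1
  rw [← h1]
  refine lintegral_congr_ae ?_
  filter_upwards [ae_det_gaussianMatrix_ne_zero h] with A hA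
  rw [sum_sq_sub_pinv_mul hA]

end

section
variable {m k : Type*} [Fintype m] [Fintype k] [DecidableEq k]

theorem aemeasurable_pinv_gaussianMatrix' (h : Fintype.card k + 2 ≤ Fintype.card m)
    (a : k) (i : m) :
    AEMeasurable (fun A => pinv (Matrix.of A) a i) (gaussianMatrix m k) := by
  have h1 := (aemeasurable_pinv_gaussianMatrix h i a).comp_quasiMeasurePreserving
    (measurePreserving_transpose_gaussianMatrix m k).quasiMeasurePreserving
  refine h1.congr (Filter.Eventually.of_forall fun A => ?_)
  exact congrFun (congrFun (pinv_transpose (Matrix.of A)) i) a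

theorem lintegral_sum_sq_pinv' (h : Fintype.card k + 2 ≤ Fintype.card m) :
    ∫⁻ A, ENNReal.ofReal (∑ a, ∑ i, pinv (Matrix.of A) a i ^ 2) ∂gaussianMatrix m k =
      ENNReal.ofReal ((Fintype.card k : ℝ) / ((Fintype.card m : ℝ) - Fintype.card k - 1)) := by
  have hmp := measurePreserving_transpose_gaussianMatrix m k
  rw [← lintegral_sum_sq_pinv h, ← hmp.map_eq, lintegral_map' _ hmp.measurable.aemeasurable]
  · refine lintegral_congr fun A => ?_
    have : pinv (Matrix.of fun j i => A i j) = (pinv (Matrix.of A))ᵀ :=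
      pinv_transpose (Matrix.of A)
    simp only [this, Matrix.transpose_apply]
    rw [Finset.sum_comm]
  · rw [hmp.map_eq]
    exact (Finset.aemeasurable_fun_sum _ fun a _ => Finset.aemeasurable_fun_sum _ fun i _ =>
      (aemeasurable_pinv_gaussianMatrix h a i).pow_const 2).ennreal_ofReal

/-- A tall Gaussian matrix almost surely has full column rank, so `A⁺A = 1` and there is no bias. -/
theorem lintegral_sum_sq_sub_pinv_mul' (h : Fintype.card k + 2 ≤ Fintype.card m) (u : k → ℝ) :
    ∫⁻ A, ENNReal.ofReal (∑ a, (u a - ((pinv (Matrix.of A) * Matrix.of A) *ᵥ u) a) ^ 2)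
        ∂gaussianMatrix m k = 0 := by
  have hmp := measurePreserving_transpose_gaussianMatrix m k
  have hae := ae_det_gaussianMatrix_ne_zero h
  rw [← hmp.map_eq] at hae
  have h1 := ae_of_ae_map hmp.measurable.aemeasurable hae
  rw [← lintegral_zero (μ := gaussianMatrix m k)]
  refine lintegral_congr_ae ?_
  filter_upwards [h1] with A hA
  have h2 : pinv (Matrix.of A) * Matrix.of A = 1 := by
    have h3 := mul_pinv_of_det_ne_zero hA
    have h4 : (Matrix.of fun j i => A i j) = (Matrix.of A)ᵀ := rfl
    rw [h4, pinv_transpose, ← Matrix.transpose_mul] at h3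
    rw [← Matrix.transpose_transpose (pinv _ * _), h3, Matrix.transpose_one]
  simp [h2]

end

/-! ### Calculus of centred square-integrable variables -/

/-- The random variable `f` is square integrable, centred, and has variance `s`. -/
structure HasCenteredVariance {α : Type*} [MeasurableSpace α] (f : α → ℝ) (s : ℝ)
    (μ : Measure α) : Prop where
  memLp : MemLp f 2 μ
  integral_eq_zero : ∫ x, f x ∂μ = 0
  integral_sq : ∫ x, f x ^ 2 ∂μ = s

namespace HasCenteredVariance

variable {α β : Type*} [MeasurableSpace α] [MeasurableSpace β] {μ : Measure α} {ν : Measure β}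
  {f : α → ℝ} {g : β → ℝ} {s t : ℝ}

theorem nonneg (hf : HasCenteredVariance f s μ) : 0 ≤ s :=
  hf.integral_sq ▸ integral_nonneg fun _ => sq_nonneg _

theorem gaussianReal : HasCenteredVariance (fun x : ℝ => x) 1 (gaussianReal 0 1) where
  memLp := IsGaussian.memLp_two_id
  integral_eq_zero := integral_id_gaussianReal
  integral_sq := by
    have h := variance_of_integral_eq_zero (X := fun x : ℝ => x) (μ := ProbabilityTheory.gaussianReal 0 1)
      aemeasurable_id integral_id_gaussianReal
    have h2 := variance_fun_id_gaussianReal (μ := 0) (v := 1)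
    rw [h2] at h
    simpa using h.symm

theorem const_mul (hf : HasCenteredVariance f s μ) (c : ℝ) :
    HasCenteredVariance (fun x => c * f x) (c ^ 2 * s) μ where
  memLp := hf.memLp.const_mul c
  integral_eq_zero := by rw [integral_const_mul, hf.integral_eq_zero, mul_zero]
  integral_sq := by simp_rw [mul_pow]; rw [integral_const_mul, hf.integral_sq]

theorem comp_measurePreserving (hg : HasCenteredVariance g t ν) {φ : α → β}
    (hφ : MeasurePreserving φ μ ν) : HasCenteredVariance (fun x => g (φ x)) t μ where
  memLp := hg.memLp.comp_measurePreserving hφ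
  integral_eq_zero := by
    have h := hg.memLp.aestronglyMeasurable
    rw [← hφ.map_eq] at h
    rw [← integral_map hφ.measurable.aemeasurable h, hφ.map_eq, hg.integral_eq_zero]
  integral_sq := by
    have h := (hg.memLp.aestronglyMeasurable.pow 2)
    rw [← hφ.map_eq] at h
    have h2 := integral_map hφ.measurable.aemeasurable h
    rw [hφ.map_eq] at h2
    exact h2.symm.trans hg.integral_sq

theorem of_map {φ : α → β} (hφ : AEMeasurable φ μ) (hg : Measurable g)
    (h : HasCenteredVariance (fun x => g (φ x)) t μ) : HasCenteredVariance g t (μ.map φ) where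
  memLp := (memLp_map_measure_iff hg.aestronglyMeasurable hφ).mpr h.memLp
  integral_eq_zero := by rw [integral_map hφ hg.aestronglyMeasurable, h.integral_eq_zero]
  integral_sq := by
    rw [integral_map hφ (hg.pow_const 2).aestronglyMeasurable, h.integral_sq]

theorem add_prod [IsProbabilityMeasure μ] [IsProbabilityMeasure ν]
    (hf : HasCenteredVariance f s μ) (hg : HasCenteredVariance g t ν) :
    HasCenteredVariance (fun q : α × β => f q.1 + g q.2) (s + t) (μ.prod ν) := by
  have hf' := hf.comp_measurePreserving (measurePreserving_fst (μ := μ) (ν := ν))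
  have hg' := hg.comp_measurePreserving (measurePreserving_snd (μ := μ) (ν := ν))
  have hfi := hf'.memLp.integrable (by norm_num)
  have hgi := hg'.memLp.integrable (by norm_num)
  refine ⟨hf'.memLp.add hg'.memLp, ?_, ?_⟩
  · rw [integral_add hfi hgi, hf'.integral_eq_zero, hg'.integral_eq_zero, add_zero]
  · have hfg : Integrable (fun q : α × β => 2 * (f q.1 * g q.2)) (μ.prod ν) :=
      ((hf.memLp.integrable (by norm_num)).mul_prod (hg.memLp.integrable (by norm_num))).const_mul 2
    have h0 : ∀ q : α × β, (f q.1 + g q.2) ^ 2 = f q.1 ^ 2 + 2 * (f q.1 * g q.2) + g q.2 ^ 2 :=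
      fun q => by ring
    have hsum : Integrable (fun q : α × β => f q.1 ^ 2 + 2 * (f q.1 * g q.2)) (μ.prod ν) :=
      hf'.memLp.integrable_sq.add hfg
    simp_rw [h0]
    rw [integral_add hsum hg'.memLp.integrable_sq,
      integral_add hf'.memLp.integrable_sq hfg, hf'.integral_sq, hg'.integral_sq,
      integral_const_mul, integral_prod_mul, hf.integral_eq_zero]
    ring

theorem sum_pi {ι : Type*} [Fintype ι] [IsProbabilityMeasure μ] (hf : HasCenteredVariance f s μ)
    (l : ι → ℝ) :
    HasCenteredVariance (fun z : ι → α => ∑ i, l i * f (z i)) (s * ∑ i, l i ^ 2)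
      (Measure.pi fun _ => μ) := by
  have hi : ∀ i, HasCenteredVariance (fun z : ι → α => l i * f (z i)) (l i ^ 2 * s)
      (Measure.pi fun _ => μ) := fun i =>
    (hf.const_mul (l i)).comp_measurePreserving (measurePreserving_eval (fun _ => μ) i)
  have hmem : MemLp (fun z : ι → α => ∑ i, l i * f (z i)) 2 (Measure.pi fun _ => μ) :=
    memLp_finsetSum _ fun i _ => (hi i).memLp
  have h0 : ∫ z : ι → α, ∑ i, l i * f (z i) ∂(Measure.pi fun _ => μ) = 0 := by
    rw [integral_finsetSum _ fun i _ => (hi i).memLp.integrable (by norm_num)]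
    exact Finset.sum_eq_zero fun i _ => (hi i).integral_eq_zero
  refine ⟨hmem, h0, ?_⟩
  rw [← variance_of_integral_eq_zero hmem.aemeasurable h0]
  have h1 := variance_sum_pi (μ := fun _ : ι => μ) (X := fun i x => l i * f x)
    fun i => (hf.const_mul (l i)).memLp
  have h2 : (∑ i, fun z : ι → α => l i * f (z i)) = fun z : ι → α => ∑ i, l i * f (z i) := by
    ext z; simp
  rw [h2] at h1
  rw [h1, Finset.mul_sum]
  refine Finset.sum_congr rfl fun i _ => ?_
  rw [variance_of_integral_eq_zero (hf.const_mul (l i)).memLp.aemeasurable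
    (hf.const_mul (l i)).integral_eq_zero, (hf.const_mul (l i)).integral_sq, mul_comm]

theorem lintegral_sq_const_sub [IsProbabilityMeasure μ] (hf : HasCenteredVariance f s μ) (c : ℝ) :
    ∫⁻ x, ENNReal.ofReal ((c - f x) ^ 2) ∂μ = ENNReal.ofReal (c ^ 2 + s) := by
  have hint : Integrable (fun x => (c - f x) ^ 2) μ := ((memLp_const c).sub hf.memLp).integrable_sq
  rw [← ofReal_integral_eq_lintegral_ofReal hint
    (Filter.Eventually.of_forall fun _ => sq_nonneg _)]
  congr 1
  have h0 : ∀ x, (c - f x) ^ 2 = c ^ 2 - 2 * c * f x + f x ^ 2 := fun x => by ring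
  have hfi := hf.memLp.integrable (by norm_num)
  have hsub : Integrable (fun x => c ^ 2 - 2 * c * f x) μ :=
    (integrable_const _).sub (hfi.const_mul _)
  simp_rw [h0]
  rw [integral_add hsub hf.memLp.integrable_sq,
    integral_sub (integrable_const _) (hfi.const_mul _), integral_const_mul, hf.integral_eq_zero,
    hf.integral_sq]
  simp

end HasCenteredVariance

/-! ### The linear model and its splitting along a set of features -/

section
variable {d : ℕ} (w : EuclideanSpace ℝ (Fin d)) (σ : ℝ)

/-- The law of `(x, xᵀw + σε)` for independent standard Gaussian `x` and `ε`. -/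
noncomputable def linearModelLaw : Measure (EuclideanSpace ℝ (Fin d) × ℝ) :=
  ((stdGaussian (EuclideanSpace ℝ (Fin d))).prod (gaussianReal 0 1)).map
    fun q => (q.1, ⟪q.1, w⟫_ℝ + σ * q.2)

theorem measurePreserving_linearModelLaw :
    MeasurePreserving (fun q : (Fin d → ℝ) × ℝ =>
        ((WithLp.toLp 2 q.1 : EuclideanSpace ℝ (Fin d)), ∑ j, q.1 j * w j + σ * q.2))
      ((Measure.pi fun _ => gaussianReal 0 1).prod (gaussianReal 0 1)) (linearModelLaw w σ) := by
  have h1 : MeasurePreserving (fun q : EuclideanSpace ℝ (Fin d) × ℝ => (q.1, ⟪q.1, w⟫_ℝ + σ * q.2))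
      ((stdGaussian (EuclideanSpace ℝ (Fin d))).prod (gaussianReal 0 1)) (linearModelLaw w σ) :=
    ⟨by fun_prop, rfl⟩
  have h2 := h1.comp ((measurePreserving_toLp_gaussian (Fin d)).prod
    (MeasurePreserving.id (gaussianReal 0 1)))
  convert h2 using 1
  ext q
  · rfl
  · simp [PiLp.inner_apply, mul_comm]

instance : IsProbabilityMeasure (linearModelLaw w σ) :=
  (measurePreserving_linearModelLaw w σ).map_eq ▸ Measure.isProbabilityMeasure_map
    (measurePreserving_linearModelLaw w σ).measurable.aemeasurable

/-- The error is `⟪x, w - v⟫ + σε`. Applied with `v` the estimator of a frozen training sample, this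
evaluates the integral over the test point. -/
theorem hasCenteredVariance_linearModelLaw (v : EuclideanSpace ℝ (Fin d)) :
    HasCenteredVariance (fun q : EuclideanSpace ℝ (Fin d) × ℝ => q.2 - ⟪q.1, v⟫_ℝ)
      (‖w - v‖ ^ 2 + σ ^ 2) (linearModelLaw w σ) := by
  have hmp := measurePreserving_linearModelLaw w σ
  rw [← hmp.map_eq]
  refine HasCenteredVariance.of_map hmp.measurable.aemeasurable (by fun_prop) ?_
  have h := (HasCenteredVariance.gaussianReal.sum_pi (w - v).ofLp).add_prod
    (HasCenteredVariance.gaussianReal.const_mul σ)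
  rw [EuclideanSpace.real_norm_sq_eq]
  convert h using 1
  · ext q
    simp only [PiLp.inner_apply, PiLp.sub_apply, sub_mul, Finset.sum_sub_distrib]
    simp [mul_comm]
    ring
  · ring

variable (S : Finset (Fin d))

/-- The part of the response not explained by the features in `S`, as a function of the other
features and of the noise. -/
noncomputable def unselectedNoise (q : ({j // j ∉ S} → ℝ) × ℝ) : ℝ :=
  ∑ j : {j // j ∉ S}, w j * q.1 j + σ * q.2

/-- The law of `unselectedNoise`. -/
noncomputable def unselectedNoiseLaw : Measure ℝ :=
  ((Measure.pi fun _ : {j // j ∉ S} => gaussianReal 0 1).prod (gaussianReal 0 1)).map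
    (unselectedNoise w σ S)

theorem measurePreserving_unselectedNoise :
    MeasurePreserving (unselectedNoise w σ S)
      ((Measure.pi fun _ : {j // j ∉ S} => gaussianReal 0 1).prod (gaussianReal 0 1))
      (unselectedNoiseLaw w σ S) :=
  ⟨by unfold unselectedNoise; fun_prop, rfl⟩

instance : IsProbabilityMeasure (unselectedNoiseLaw w σ S) :=
  (measurePreserving_unselectedNoise w σ S).map_eq ▸ Measure.isProbabilityMeasure_map
    (measurePreserving_unselectedNoise w σ S).measurable.aemeasurable

theorem hasCenteredVariance_unselectedNoiseLaw :
    HasCenteredVariance (fun z => z) (∑ j : {j // j ∉ S}, w j ^ 2 + σ ^ 2)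
      (unselectedNoiseLaw w σ S) := by
  have hmp := measurePreserving_unselectedNoise w σ S
  refine HasCenteredVariance.of_map hmp.measurable.aemeasurable measurable_id ?_
  have h := (HasCenteredVariance.gaussianReal.sum_pi
    (fun j : {j // j ∉ S} => w j)).add_prod (HasCenteredVariance.gaussianReal.const_mul σ)
  simp only [one_mul, mul_one] at h
  exact h

/-- Selected features, and residual of the response on the selected part of the signal. -/
noncomputable def selectedSplit (q : EuclideanSpace ℝ (Fin d) × ℝ) : (S → ℝ) × ℝ :=
  (fun j => q.1 j, q.2 - ∑ j : S, q.1 j * w j)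

/-- Subtracting the selected signal leaves a function of the unselected coordinates and the noise
only, hence independence from the selected features. -/
theorem measurePreserving_selectedSplit :
    MeasurePreserving (selectedSplit w S) (linearModelLaw w σ)
      ((Measure.pi fun _ : S => gaussianReal 0 1).prod (unselectedNoiseLaw w σ S)) := by
  have hmeas : Measurable (selectedSplit w S) := by unfold selectedSplit; fun_prop
  refine ⟨hmeas, ?_⟩
  have h1 := measurePreserving_linearModelLaw w σ
  have h0 : MeasurePreserving
      (MeasurableEquiv.piEquivPiSubtypeProd (fun _ : Fin d => ℝ) (fun j => j ∈ S))
      (Measure.pi fun _ => gaussianReal 0 1)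
      ((Measure.pi fun _ : S => gaussianReal 0 1).prod
        (Measure.pi fun _ : {j // j ∉ S} => gaussianReal 0 1)) := by
    convert measurePreserving_piEquivPiSubtypeProd (fun _ : Fin d => gaussianReal 0 1)
      (fun j => j ∈ S)
  have h2 := h0.prod (MeasurePreserving.id (gaussianReal 0 1))
  have h3 := measurePreserving_prodAssoc (Measure.pi fun _ : {j // j ∈ S} => gaussianReal 0 1)
    (Measure.pi fun _ : {j // j ∉ S} => gaussianReal 0 1) (gaussianReal 0 1)
  have h4 := (MeasurePreserving.id (Measure.pi fun _ : {j // j ∈ S} => gaussianReal 0 1)).prod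
    (measurePreserving_unselectedNoise w σ S)
  have h5 := h4.comp (h3.comp h2)
  rw [← h1.map_eq, Measure.map_map hmeas h1.measurable]
  refine Eq.trans ?_ h5.map_eq
  congr 1
  ext q
  · rfl
  · have hs : ∑ j : S, q.1 j * w j + ∑ j : {j // j ∉ S}, q.1 j * w j = ∑ j, q.1 j * w j := by
      convert Fintype.sum_subtype_add_sum_subtype (fun j => j ∈ S) (fun j => q.1 j * w j)
    simp only [selectedSplit, Function.comp_apply, Prod.map, id, MeasurableEquiv.prodAssoc,
      unselectedNoise, MeasurableEquiv.coe_mk, Equiv.prodAssoc_apply,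
      MeasurableEquiv.piEquivPiSubtypeProd, Equiv.piEquivPiSubtypeProd_apply]
    rw [← hs]
    simp only [mul_comm (w _)]
    ring

end

/-! ### Bias-variance decomposition of the risk for a fixed set of features -/

section
variable {m k : Type*} [Fintype m] [Fintype k] {ν : Measure ℝ}

theorem aemeasurable_sub_pinv_mulVec
    (hmeas : ∀ a i, AEMeasurable (fun A => pinv (Matrix.of A) a i) (gaussianMatrix m k))
    (u : k → ℝ) (a : k) :
    AEMeasurable (fun q : (m → k → ℝ) × (m → ℝ) =>
      u a - (pinv (Matrix.of q.1) *ᵥ (Matrix.of q.1 *ᵥ u + q.2)) a)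
      ((gaussianMatrix m k).prod (Measure.pi fun _ => ν)) := by
  simp only [Matrix.mulVec, dotProduct, Pi.add_apply, Matrix.of_apply]
  refine aemeasurable_const.sub (Finset.aemeasurable_fun_sum _ fun i _ => ?_)
  refine ((hmeas a i).comp_quasiMeasurePreserving Measure.quasiMeasurePreserving_fst).mul ?_
  exact Measurable.aemeasurable (by fun_prop)

/-- Given `A`, each coordinate of the error is the constant bias `u - A⁺Au` minus a linear form in
the noise, whose variance is `τ` times the squared norm of a row of `A⁺`. -/
theorem lintegral_sq_sub_pinv_mulVec [IsProbabilityMeasure ν] {τ : ℝ} (hν : HasCenteredVariance (fun z => z) τ ν)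
    (hmeas : ∀ a i, AEMeasurable (fun A => pinv (Matrix.of A) a i) (gaussianMatrix m k))
    (u : k → ℝ) :
    ∫⁻ q, ENNReal.ofReal
        (∑ a, (u a - (pinv (Matrix.of q.1) *ᵥ (Matrix.of q.1 *ᵥ u + q.2)) a) ^ 2)
        ∂(gaussianMatrix m k).prod (Measure.pi fun _ => ν) =
      ∫⁻ A, ENNReal.ofReal (∑ a, (u a - ((pinv (Matrix.of A) * Matrix.of A) *ᵥ u) a) ^ 2)
          ∂gaussianMatrix m k +
        ENNReal.ofReal τ *
          ∫⁻ A, ENNReal.ofReal (∑ a, ∑ i, pinv (Matrix.of A) a i ^ 2) ∂gaussianMatrix m k := by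
  have hmeas1 : AEMeasurable (fun A => ENNReal.ofReal (∑ a, ∑ i, pinv (Matrix.of A) a i ^ 2))
      (gaussianMatrix m k) :=
    (Finset.aemeasurable_fun_sum _ fun a _ => Finset.aemeasurable_fun_sum _ fun i _ =>
      (hmeas a i).pow_const 2).ennreal_ofReal
  rw [lintegral_prod _ (Finset.aemeasurable_fun_sum _ fun a _ =>
    (aemeasurable_sub_pinv_mulVec hmeas u a).pow_const 2).ennreal_ofReal,
    ← lintegral_const_mul'' _ hmeas1, ← lintegral_add_right' _ (hmeas1.const_mul _)]
  refine lintegral_congr fun A => ?_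
  set M := pinv (Matrix.of A)
  have h1 : ∀ a, ∫⁻ z, ENNReal.ofReal ((u a - (M *ᵥ (Matrix.of A *ᵥ u + z)) a) ^ 2)
      ∂(Measure.pi fun _ => ν) =
      ENNReal.ofReal ((u a - ((M * Matrix.of A) *ᵥ u) a) ^ 2 + τ * ∑ i, M a i ^ 2) := by
    intro a
    rw [← (hν.sum_pi (M a)).lintegral_sq_const_sub]
    refine lintegral_congr fun z => ?_
    congr 2
    rw [Matrix.mulVec_add, Matrix.mulVec_mulVec, Pi.add_apply, ← sub_sub]
    rfl
  calc ∫⁻ z, ENNReal.ofReal (∑ a, (u a - (M *ᵥ (Matrix.of A *ᵥ u + z)) a) ^ 2)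
        ∂(Measure.pi fun _ => ν)
      = ∑ a, ∫⁻ z, ENNReal.ofReal ((u a - (M *ᵥ (Matrix.of A *ᵥ u + z)) a) ^ 2)
        ∂(Measure.pi fun _ => ν) := by
        rw [← lintegral_finsetSum]
        · exact lintegral_congr fun z => ENNReal.ofReal_sum_of_nonneg fun _ _ => sq_nonneg _
        · intro a _
          simp only [Matrix.mulVec, dotProduct, Pi.add_apply, Matrix.of_apply]
          fun_prop
    _ = ENNReal.ofReal (∑ a, ((u a - ((M * Matrix.of A) *ᵥ u) a) ^ 2 + τ * ∑ i, M a i ^ 2)) := by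
        simp_rw [h1]
        rw [ENNReal.ofReal_sum_of_nonneg]
        intro a _
        have := hν.nonneg
        positivity
    _ = _ := by
        rw [Finset.sum_add_distrib, ← Finset.mul_sum, ENNReal.ofReal_add (by positivity)
          (mul_nonneg hν.nonneg (by positivity)), ENNReal.ofReal_mul hν.nonneg]

end

section
variable {n d : ℕ} (w : EuclideanSpace ℝ (Fin d)) (σ : ℝ) (S : Finset (Fin d))

/-- Selected design matrix and residual vector of a training sample. -/
noncomputable def trainingSplit (D : Fin n → EuclideanSpace ℝ (Fin d) × ℝ) :
    (Fin n → S → ℝ) × (Fin n → ℝ) :=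
  (fun i => (selectedSplit w S (D i)).1, fun i => (selectedSplit w S (D i)).2)

theorem measurePreserving_trainingSplit :
    MeasurePreserving (trainingSplit (n := n) w S) (Measure.pi fun _ => linearModelLaw w σ)
      ((gaussianMatrix (Fin n) S).prod (Measure.pi fun _ => unselectedNoiseLaw w σ S)) :=
  (measurePreserving_arrowProdEquivProdArrow (S → ℝ) ℝ (Fin n) _ _).comp
    (measurePreserving_pi _ _ fun _ => measurePreserving_selectedSplit w σ S)

/-- The estimator computed from a sample of pairs. -/
noncomputable def sampleEstimator (D : Fin n → EuclideanSpace ℝ (Fin d) × ℝ) :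
    EuclideanSpace ℝ (Fin d) :=
  minNormEstimator S (fun i => (D i).1) (fun i => (D i).2)

variable {S} in
theorem sampleEstimator_of_notMem (D : Fin n → EuclideanSpace ℝ (Fin d) × ℝ) {j : Fin d}
    (hj : j ∉ S) : sampleEstimator S D j = 0 := by
  simp [sampleEstimator, minNormEstimator, hj]

theorem sampleEstimator_of_mem (D : Fin n → EuclideanSpace ℝ (Fin d) × ℝ) (j : S) :
    sampleEstimator S D j =
      (pinv (Matrix.of (trainingSplit w S D).1) *ᵥ (Matrix.of (trainingSplit w S D).1 *ᵥ
        (fun j : S => w j) + (trainingSplit w S D).2)) j := by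
  have h1 : Matrix.of (trainingSplit w S D).1 *ᵥ (fun j : S => w j) + (trainingSplit w S D).2 =
      fun i => (D i).2 := by
    ext i
    simp [trainingSplit, selectedSplit, Matrix.mulVec, dotProduct]
  rw [h1]
  simp only [sampleEstimator, minNormEstimator, j.2, dite_true]
  rfl

theorem norm_sq_sub_sampleEstimator (D : Fin n → EuclideanSpace ℝ (Fin d) × ℝ) :
    ‖w - sampleEstimator S D‖ ^ 2 = ∑ j : {j // j ∉ S}, w j ^ 2 +
      ∑ j : S, (w j - (pinv (Matrix.of (trainingSplit w S D).1) *ᵥ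
        (Matrix.of (trainingSplit w S D).1 *ᵥ (fun j : S => w j) + (trainingSplit w S D).2)) j) ^ 2
      := by
  have hs : ∑ j : S, (w - sampleEstimator S D) j ^ 2 +
      ∑ j : {j // j ∉ S}, (w - sampleEstimator S D) j ^ 2 =
      ∑ j, (w - sampleEstimator S D) j ^ 2 := by
    convert Fintype.sum_subtype_add_sum_subtype (fun j => j ∈ S)
      (fun j => (w - sampleEstimator S D) j ^ 2)
  rw [EuclideanSpace.real_norm_sq_eq, ← hs, add_comm]
  congr 1
  · refine Finset.sum_congr rfl fun j _ => ?_
    rw [PiLp.sub_apply, sampleEstimator_of_notMem D j.2, sub_zero]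
  · refine Finset.sum_congr rfl fun j _ => ?_
    rw [PiLp.sub_apply, sampleEstimator_of_mem w]

variable {S}
variable (hmeas : ∀ a i, AEMeasurable (fun A => pinv (Matrix.of A) a i) (gaussianMatrix (Fin n) S))
include hmeas

theorem aemeasurable_sampleEstimator (j : Fin d) :
    AEMeasurable (fun D : Fin n → EuclideanSpace ℝ (Fin d) × ℝ => sampleEstimator S D j)
      (Measure.pi fun _ => linearModelLaw w σ) := by
  by_cases hj : j ∈ S
  · have h1 := (aemeasurable_sub_pinv_mulVec (ν := unselectedNoiseLaw w σ S) hmeas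
      (fun j => w j) ⟨j, hj⟩).comp_quasiMeasurePreserving
      (measurePreserving_trainingSplit (n := n) w σ S).quasiMeasurePreserving
    refine (aemeasurable_const (b := w j) |>.sub h1).congr (Filter.Eventually.of_forall fun D => ?_)
    have := sampleEstimator_of_mem w S D ⟨j, hj⟩
    simp only [Function.comp_apply, Pi.sub_apply, this, sub_sub_cancel]
  · simp_rw [sampleEstimator_of_notMem _ hj]
    exact aemeasurable_const

theorem aemeasurable_prediction_error :
    AEMeasurable (fun q : (EuclideanSpace ℝ (Fin d) × ℝ) × (Fin n → EuclideanSpace ℝ (Fin d) × ℝ) =>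
      (q.1.2 - ⟪q.1.1, sampleEstimator S q.2⟫_ℝ) ^ 2)
      ((linearModelLaw w σ).prod (Measure.pi fun _ => linearModelLaw w σ)) := by
  refine AEMeasurable.pow_const (AEMeasurable.sub (by fun_prop) ?_) 2
  simp only [PiLp.inner_apply]
  refine Finset.aemeasurable_fun_sum _ fun j _ => ?_
  have h1 := (aemeasurable_sampleEstimator w σ hmeas j).comp_quasiMeasurePreserving
    (Measure.quasiMeasurePreserving_snd (μ := linearModelLaw w σ))
  have h2 : Measurable fun q : (EuclideanSpace ℝ (Fin d) × ℝ) ×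
      (Fin n → EuclideanSpace ℝ (Fin d) × ℝ) => q.1.1 j := by fun_prop
  exact (h1.mul h2.aemeasurable)

theorem lintegral_prediction_error :
    ∫⁻ q, ENNReal.ofReal ((q.1.2 - ⟪q.1.1, sampleEstimator S q.2⟫_ℝ) ^ 2)
        ∂(linearModelLaw w σ).prod (Measure.pi fun _ : Fin n => linearModelLaw w σ) =
      ENNReal.ofReal (∑ j : {j // j ∉ S}, w j ^ 2 + σ ^ 2) +
      (∫⁻ A, ENNReal.ofReal
          (∑ a : S, (w a - ((pinv (Matrix.of A) * Matrix.of A) *ᵥ (fun j : S => w j)) a) ^ 2)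
          ∂gaussianMatrix (Fin n) S +
        ENNReal.ofReal (∑ j : {j // j ∉ S}, w j ^ 2 + σ ^ 2) *
          ∫⁻ A, ENNReal.ofReal (∑ a, ∑ i, pinv (Matrix.of A) a i ^ 2)
            ∂gaussianMatrix (Fin n) S) := by
  have hmp := measurePreserving_trainingSplit (n := n) w σ S
  -- The test point is integrated first, so that the estimator is a fixed vector in the inner
  -- integral.
  rw [lintegral_prod_symm _ (aemeasurable_prediction_error w σ hmeas).ennreal_ofReal]
  have hmeas2 := (Finset.aemeasurable_fun_sum Finset.univ fun a _ =>
      (aemeasurable_sub_pinv_mulVec (ν := unselectedNoiseLaw w σ S) hmeas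
        (fun j : S => w j) a).pow_const 2).ennreal_ofReal
  rw [← lintegral_sq_sub_pinv_mulVec (hasCenteredVariance_unselectedNoiseLaw w σ S) hmeas,
    ← hmp.map_eq, lintegral_map' (by rw [hmp.map_eq]; exact hmeas2) hmp.measurable.aemeasurable]
  have h1 : ∀ D : Fin n → EuclideanSpace ℝ (Fin d) × ℝ,
      ∫⁻ x, ENNReal.ofReal ((x.2 - ⟪x.1, sampleEstimator S D⟫_ℝ) ^ 2) ∂linearModelLaw w σ =
      ENNReal.ofReal (∑ j : {j // j ∉ S}, w j ^ 2 + σ ^ 2) + ENNReal.ofReal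
        (∑ j : S, (w j - (pinv (Matrix.of (trainingSplit w S D).1) *ᵥ
          (Matrix.of (trainingSplit w S D).1 *ᵥ (fun j : S => w j) +
            (trainingSplit w S D).2)) j) ^ 2) := by
    intro D
    have h2 := (hasCenteredVariance_linearModelLaw w σ
      (sampleEstimator S D)).lintegral_sq_const_sub 0
    simp only [zero_sub, neg_sq, ne_eq, OfNat.ofNat_ne_zero, not_false_eq_true, zero_pow,
      zero_add] at h2
    rw [h2, norm_sq_sub_sampleEstimator, ← ENNReal.ofReal_add (by positivity) (by positivity)]
    congr 1
    ring
  simp_rw [h1]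
  rw [lintegral_add_left measurable_const, lintegral_const, measure_univ, mul_one]

end

/-! ### Averaging over a uniformly random set of features -/

theorem sum_powersetCard_sum {d p : ℕ} (hp : 1 ≤ p) (hpd : p ≤ d) (a : Fin d → ℝ) :
    (∑ S ∈ Finset.powersetCard p Finset.univ, ∑ j ∈ S, a j) / (d.choose p : ℝ) =
      (p : ℝ) / d * ∑ j, a j := by
  have hd : (d : ℝ) ≠ 0 := by exact_mod_cast (by omega : d ≠ 0)
  have hc : (d.choose p : ℝ) ≠ 0 := by exact_mod_cast (Nat.choose_pos hpd).ne'
  -- Each index lies in a fraction `p/d` of the `p`-subsets: count those avoiding `j`, then use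
  -- Pascal's rule and absorption.
  have hcard : ∀ j : Fin d,
      (((Finset.powersetCard p Finset.univ).filter fun S => j ∈ S).card : ℝ) =
        (d.choose p : ℝ) * p / d := by
    intro j
    have h1 : (Finset.powersetCard p Finset.univ).filter (fun S => j ∉ S) =
        Finset.powersetCard p (Finset.univ.erase j) := by
      ext S
      simp [Finset.mem_powersetCard, Finset.subset_erase, and_comm]
    have h2 := Finset.card_filter_add_card_filter_not (s := Finset.powersetCard p Finset.univ)
      (fun S : Finset (Fin d) => j ∈ S)
    rw [h1] at h2
    simp only [Finset.card_powersetCard, Finset.card_erase_of_mem (Finset.mem_univ j),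
      Finset.card_univ, Fintype.card_fin] at h2
    obtain ⟨d', rfl⟩ : ∃ d', d = d' + 1 := ⟨d - 1, by omega⟩
    obtain ⟨p', rfl⟩ : ∃ p', p = p' + 1 := ⟨p - 1, by omega⟩
    have h3 := Nat.choose_succ_succ d' p'
    have h4 := Nat.add_one_mul_choose_eq d' p'
    simp only [Nat.add_sub_cancel] at h2
    rw [eq_div_iff hd]
    have h5 : ((Finset.powersetCard (p' + 1) Finset.univ).filter fun S => j ∈ S).card =
      d'.choose p' := by
      simp only [Nat.succ_eq_add_one] at h3
      omega
    rw [h5, mul_comm]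
    exact_mod_cast h4
  have hswap : ∑ S ∈ Finset.powersetCard p Finset.univ, ∑ j ∈ S, a j =
      ∑ j, (((Finset.powersetCard p Finset.univ).filter fun S => j ∈ S).card : ℝ) * a j := by
    have h6 : ∀ S : Finset (Fin d), ∑ j ∈ S, a j = ∑ j, if j ∈ S then a j else 0 := by
      intro S; simp
    simp_rw [h6]
    rw [Finset.sum_comm]
    refine Finset.sum_congr rfl fun j _ => ?_
    rw [← Finset.sum_filter, Finset.sum_const, nsmul_eq_mul]
  rw [hswap]
  simp_rw [hcard]
  rw [← Finset.mul_sum]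
  field_simp

theorem average_affine_sum_powersetCard {d p : ℕ} (hp : 1 ≤ p) (hpd : p ≤ d) (a : Fin d → ℝ)
    (α β : ℝ) :
    (∑ S ∈ Finset.powersetCard p Finset.univ, (α + β * ∑ j ∈ S, a j)) / (d.choose p : ℝ) =
      α + β * ((p : ℝ) / d * ∑ j, a j) := by
  have hc : (d.choose p : ℝ) ≠ 0 := by exact_mod_cast (Nat.choose_pos hpd).ne'
  rw [← sum_powersetCard_sum hp hpd, Finset.sum_add_distrib, ← Finset.mul_sum, Finset.sum_const,
    Finset.card_powersetCard, Finset.card_univ, Fintype.card_fin, nsmul_eq_mul]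
  field_simp

theorem lintegral_uniformOn_finset {α : Type*} [MeasurableSpace α] [MeasurableSingletonClass α]
    (s : Finset α) (f : α → ℝ≥0∞) :
    ∫⁻ x, f x ∂uniformOn (s : Set α) = (s.card : ℝ≥0∞)⁻¹ * ∑ x ∈ s, f x := by
  rw [uniformOn, ProbabilityTheory.cond, lintegral_smul_measure, lintegral_finset,
    Measure.count_apply_finset, smul_eq_mul]
  simp

/-- Independence makes the joint law a product, and the average over `S` is a finite sum. Computing
the extended integral first yields integrability and value together. -/
theorem integral_uniformOn_powersetCard {Ω β : Type*} [MeasurableSpace Ω] [MeasurableSpace β]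
    {P : Measure Ω} [IsProbabilityMeasure P] {ρ : Measure β} [IsProbabilityMeasure ρ] {d p : ℕ}
    (hpd : p ≤ d) {T : Ω → Finset (Fin d)} {D : Ω → β}
    (hT : HasLaw T (uniformOn {S : Finset (Fin d) | S.card = p}) P) (hD : HasLaw D ρ P)
    (hTD : IndepFun T D P) {F : Finset (Fin d) → β → ℝ} {R : Finset (Fin d) → ℝ}
    (hF : ∀ S b, 0 ≤ F S b) (hR : ∀ S, S.card = p → 0 ≤ R S)
    (hmeas : ∀ S, S.card = p → AEMeasurable (F S) ρ)
    (hint : ∀ S, S.card = p → ∫⁻ b, ENNReal.ofReal (F S b) ∂ρ = ENNReal.ofReal (R S)) :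
    Integrable (fun ω => F (T ω) (D ω)) P ∧
      ∫ ω, F (T ω) (D ω) ∂P =
        (∑ S ∈ Finset.powersetCard p Finset.univ, R S) / (d.choose p : ℝ) := by
  classical
  set s : Finset (Finset (Fin d)) := Finset.powersetCard p Finset.univ with hs
  have hset : {S : Finset (Fin d) | S.card = p} = (s : Set (Finset (Fin d))) := by
    ext S; simp [hs]
  have hmem : ∀ S ∈ s, S.card = p := fun S hS => (Finset.mem_powersetCard.mp hS).2
  have hsc : s.card = d.choose p := by simp [hs]
  have hcpos : 0 < d.choose p := Nat.choose_pos hpd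
  rw [hset] at hT
  -- A measurable version for each `S` gives joint measurability, since there are countably many
  -- `S`. The value `0` at other cardinalities is harmless: `T` almost surely avoids them.
  let F' : Finset (Fin d) → β → ℝ := fun S =>
    if h : S.card = p then (hmeas S h).mk (F S) else fun _ => 0
  have hF'meas : ∀ S, Measurable (F' S) := by
    intro S
    by_cases h : S.card = p
    · simpa [F', h] using (hmeas S h).measurable_mk
    · simp [F', h]
  have hFF' : ∀ S, S.card = p → F S =ᵐ[ρ] F' S := by
    intro S h
    simpa [F', h] using (hmeas S h).ae_eq_mk
  have hTcard : ∀ᵐ ω ∂P, (T ω).card = p := by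
    have : ∀ᵐ S ∂P.map T, S ∈ (s : Set (Finset (Fin d))) := by
      rw [hT.map_eq, uniformOn]
      exact ae_cond_mem s.measurableSet
    filter_upwards [ae_of_ae_map hT.aemeasurable this] with ω hω
    exact hmem _ hω
  have hae : ∀ᵐ ω ∂P, F (T ω) (D ω) = F' (T ω) (D ω) := by
    have h1 : ∀ᵐ ω ∂P, ∀ S : Finset (Fin d), S.card = p → F S (D ω) = F' S (D ω) := by
      rw [ae_all_iff]
      intro S
      by_cases h : S.card = p
      · have h2 := hFF' S h
        rw [← hD.map_eq] at h2
        filter_upwards [ae_of_ae_map hD.aemeasurable h2] with ω hω _ using hω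
      · exact Filter.Eventually.of_forall fun ω h' => absurd h' h
    filter_upwards [h1, hTcard] with ω hω hω' using hω _ hω'
  have hF'm : Measurable fun q : Finset (Fin d) × β => F' q.1 q.2 :=
    measurable_from_prod_countable_right hF'meas
  have hlaw : P.map (fun ω => (T ω, D ω)) = (uniformOn (s : Set (Finset (Fin d)))).prod ρ := by
    rw [(indepFun_iff_map_prod_eq_prod_map_map hT.aemeasurable hD.aemeasurable).mp hTD,
      hT.map_eq, hD.map_eq]
  have hTDm : AEMeasurable (fun ω => (T ω, D ω)) P := hT.aemeasurable.prodMk hD.aemeasurable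
  have hFm : AEMeasurable (fun ω => F (T ω) (D ω)) P :=
    (hF'm.comp_aemeasurable hTDm).congr (hae.mono fun _ h => h.symm)
  have hnn : 0 ≤ᵐ[P] fun ω => F (T ω) (D ω) := Filter.Eventually.of_forall fun ω => hF _ _
  have hlint : ∫⁻ ω, ENNReal.ofReal (F (T ω) (D ω)) ∂P =
      ENNReal.ofReal ((∑ S ∈ s, R S) / (d.choose p : ℝ)) := by
    calc ∫⁻ ω, ENNReal.ofReal (F (T ω) (D ω)) ∂P
        = ∫⁻ ω, ENNReal.ofReal (F' (T ω) (D ω)) ∂P :=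
          lintegral_congr_ae (hae.mono fun ω h => by simp only [h])
      _ = ∫⁻ q, ENNReal.ofReal (F' q.1 q.2) ∂(uniformOn (s : Set (Finset (Fin d)))).prod ρ := by
          rw [← hlaw, lintegral_map' hF'm.ennreal_ofReal.aemeasurable hTDm]
      _ = ∫⁻ S, ∫⁻ b, ENNReal.ofReal (F' S b) ∂ρ ∂uniformOn (s : Set (Finset (Fin d))) :=
          lintegral_prod _ hF'm.ennreal_ofReal.aemeasurable
      _ = (s.card : ℝ≥0∞)⁻¹ * ∑ S ∈ s, ENNReal.ofReal (R S) := by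
          rw [lintegral_uniformOn_finset]
          congr 1
          refine Finset.sum_congr rfl fun S hS => ?_
          rw [← hint S (hmem S hS)]
          exact lintegral_congr_ae ((hFF' S (hmem S hS)).mono fun b h => by simp only [h])
      _ = _ := by
          rw [← ENNReal.ofReal_sum_of_nonneg fun S hS => hR S (hmem S hS), hsc, div_eq_inv_mul,
            ENNReal.ofReal_mul (by positivity), ENNReal.ofReal_inv_of_pos (by exact_mod_cast hcpos),
            ENNReal.ofReal_natCast]
  refine ⟨?_, ?_⟩
  · rw [← lintegral_ofReal_ne_top_iff_integrable hFm.aestronglyMeasurable hnn, hlint]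
    exact ENNReal.ofReal_ne_top
  · rw [integral_eq_lintegral_of_nonneg_ae hnn hFm.aestronglyMeasurable, hlint,
      ENNReal.toReal_ofReal]
    exact div_nonneg (Finset.sum_nonneg fun S hS => hR S (hmem S hS)) (Nat.cast_nonneg _)

theorem sum_notMem_sq {d : ℕ} (w : EuclideanSpace ℝ (Fin d)) (S : Finset (Fin d)) :
    ∑ j : {j // j ∉ S}, w j ^ 2 = ‖w‖ ^ 2 - ∑ j ∈ S, w j ^ 2 := by
  have hs : ∑ j : S, w j ^ 2 + ∑ j : {j // j ∉ S}, w j ^ 2 = ∑ j, w j ^ 2 := by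
    convert Fintype.sum_subtype_add_sum_subtype (fun j => j ∈ S) (fun j => w j ^ 2)
  rw [EuclideanSpace.real_norm_sq_eq, ← hs, Finset.sum_coe_sort S fun j => w j ^ 2]
  ring

/-! ### Explicit risk in the two regimes, and conclusion -/

section
variable {n d p : ℕ} (w : EuclideanSpace ℝ (Fin d)) (σ : ℝ) {S : Finset (Fin d)}

theorem lintegral_prediction_error_underparametrized (hS : S.card = p) (h : p + 2 ≤ n) :
    ∫⁻ q, ENNReal.ofReal ((q.1.2 - ⟪q.1.1, sampleEstimator S q.2⟫_ℝ) ^ 2)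
        ∂(linearModelLaw w σ).prod (Measure.pi fun _ : Fin n => linearModelLaw w σ) =
      ENNReal.ofReal ((∑ j : {j // j ∉ S}, w j ^ 2 + σ ^ 2) *
        (1 + (p : ℝ) / ((n : ℝ) - p - 1))) := by
  have h' : Fintype.card S + 2 ≤ Fintype.card (Fin n) := by simpa [hS] using h
  have hpn : (p : ℝ) + 2 ≤ n := by exact_mod_cast h
  have hfrac : 0 ≤ (p : ℝ) / ((n : ℝ) - p - 1) := div_nonneg (Nat.cast_nonneg _) (by linarith)
  rw [lintegral_prediction_error w σ (aemeasurable_pinv_gaussianMatrix' h'),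
    lintegral_sum_sq_sub_pinv_mul' h', lintegral_sum_sq_pinv' h', Fintype.card_coe, hS,
    Fintype.card_fin, zero_add, ← ENNReal.ofReal_mul (by positivity),
    ← ENNReal.ofReal_add (by positivity) (mul_nonneg (by positivity) hfrac)]
  congr 1
  ring

theorem lintegral_prediction_error_overparametrized (hS : S.card = p) (h : n + 2 ≤ p) :
    ∫⁻ q, ENNReal.ofReal ((q.1.2 - ⟪q.1.1, sampleEstimator S q.2⟫_ℝ) ^ 2)
        ∂(linearModelLaw w σ).prod (Measure.pi fun _ : Fin n => linearModelLaw w σ) =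
      ENNReal.ofReal ((∑ j : {j // j ∉ S}, w j ^ 2 + σ ^ 2) *
        (1 + (n : ℝ) / ((p : ℝ) - n - 1)) + (1 - (n : ℝ) / p) * ∑ j ∈ S, w j ^ 2) := by
  have h' : Fintype.card (Fin n) + 2 ≤ Fintype.card S := by simpa [hS] using h
  have hpn : (n : ℝ) + 2 ≤ p := by exact_mod_cast h
  have hfrac : 0 ≤ (n : ℝ) / ((p : ℝ) - n - 1) := div_nonneg (Nat.cast_nonneg _) (by linarith)
  have hfrac' : 0 ≤ 1 - (n : ℝ) / p := by
    rw [sub_nonneg]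
    exact div_le_one_of_le₀ (by linarith) (Nat.cast_nonneg _)
  rw [lintegral_prediction_error w σ (aemeasurable_pinv_gaussianMatrix h'),
    lintegral_sum_sq_sub_pinv_mul h', lintegral_sum_sq_pinv h', Fintype.card_coe, hS,
    Fintype.card_fin, Finset.sum_coe_sort S fun j => w j ^ 2, ← ENNReal.ofReal_mul (by positivity),
    ← ENNReal.ofReal_add (by positivity) (mul_nonneg (by positivity) hfrac),
    ← ENNReal.ofReal_add (by positivity)
      (add_nonneg (by positivity) (mul_nonneg (by positivity) hfrac))]
  congr 1
  ring

end

theorem hasLaw_linearModel {Ω : Type*} [MeasurableSpace Ω] {P : Measure Ω}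
    [IsProbabilityMeasure P] {d : ℕ} {w : EuclideanSpace ℝ (Fin d)} {σ : ℝ}
    {x : Ω → EuclideanSpace ℝ (Fin d)} {ε y : Ω → ℝ}
    (hx : HasLaw x (stdGaussian (EuclideanSpace ℝ (Fin d))) P) (hε : HasLaw ε (gaussianReal 0 1) P)
    (hxε : IndepFun x ε P) (hy : ∀ ω, y ω = ⟪x ω, w⟫_ℝ + σ * ε ω) :
    HasLaw (fun ω => (x ω, y ω)) (linearModelLaw w σ) P := by
  have h1 : HasLaw (fun ω => (x ω, ε ω))
      ((stdGaussian (EuclideanSpace ℝ (Fin d))).prod (gaussianReal 0 1)) P :=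
    ⟨hx.aemeasurable.prodMk hε.aemeasurable, by
      rw [(indepFun_iff_map_prod_eq_prod_map_map hx.aemeasurable hε.aemeasurable).mp hxε,
        hx.map_eq, hε.map_eq]⟩
  have h2 : HasLaw (fun q : EuclideanSpace ℝ (Fin d) × ℝ => (q.1, ⟪q.1, w⟫_ℝ + σ * q.2))
      (linearModelLaw w σ)
      ((stdGaussian (EuclideanSpace ℝ (Fin d))).prod (gaussianReal 0 1)) :=
    ⟨by fun_prop, rfl⟩
  simpa only [hy] using h2.fun_comp h1

theorem hasLaw_test_training {Ω β : Type*} [MeasurableSpace Ω] [MeasurableSpace β]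
    {P : Measure Ω} [IsProbabilityMeasure P] {μ : Measure β} {n : ℕ} {a : Ω → β}
    {A : Fin n → Ω → β} (ha : HasLaw a μ P) (hcopy : ∀ i, IdentDistrib (A i) a P P)
    (hiid : iIndepFun A P) (htest : IndepFun a (fun ω i => A i ω) P) :
    HasLaw (fun ω => (a ω, fun i => A i ω)) (μ.prod (Measure.pi fun _ : Fin n => μ)) P := by
  have hA : ∀ i, AEMeasurable (A i) P := fun i => (hcopy i).aemeasurable_fst
  have hpi : AEMeasurable (fun ω i => A i ω) P := aemeasurable_pi_lambda _ hA
  refine ⟨ha.aemeasurable.prodMk hpi, ?_⟩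
  rw [(indepFun_iff_map_prod_eq_prod_map_map ha.aemeasurable hpi).mp htest,
    (iIndepFun_iff_map_fun_eq_pi_map hA).mp hiid, ha.map_eq]
  simp_rw [(hcopy _).map_eq, ha.map_eq]

theorem mainTheorem2
    {Ω : Type*} [MeasurableSpace Ω] (P : MeasureTheory.Measure Ω)
    [MeasureTheory.IsProbabilityMeasure P]
    (n d p : ℕ) (hp : 1 ≤ p) (hpd : p ≤ d)
    (w : EuclideanSpace ℝ (Fin d)) (σ : ℝ) (hσ : 0 < σ)
    -- the test point: `x` standard Gaussian, `ε` standard normal, independent, `y = xᵀw + σε`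
    (x : Ω → EuclideanSpace ℝ (Fin d)) (ε y : Ω → ℝ)
    (hx : ProbabilityTheory.HasLaw x
      (ProbabilityTheory.stdGaussian (EuclideanSpace ℝ (Fin d))) P)
    (hε : ProbabilityTheory.HasLaw ε (ProbabilityTheory.gaussianReal 0 1) P)
    (hxε : ProbabilityTheory.IndepFun x ε P)
    (hy : ∀ ω, y ω = inner ℝ (x ω) w + σ * ε ω)
    -- the training sample: `n` i.i.d. copies of `(x, y)`, independent of the test point
    (X : Fin n → Ω → EuclideanSpace ℝ (Fin d)) (Y : Fin n → Ω → ℝ)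
    (hcopy : ∀ i, ProbabilityTheory.IdentDistrib
      (fun ω => (X i ω, Y i ω)) (fun ω => (x ω, y ω)) P P)
    (hiid : ProbabilityTheory.iIndepFun (fun i ω => (X i ω, Y i ω)) P)
    (htest : ProbabilityTheory.IndepFun
      (fun ω => (x ω, y ω)) (fun ω i => (X i ω, Y i ω)) P)
    -- the features: a uniformly random set of cardinality `p`, independent of all the data
    (T : Ω → Finset (Fin d))
    (hT : ProbabilityTheory.HasLaw T
      (ProbabilityTheory.uniformOn {S : Finset (Fin d) | S.card = p}) P)
    (hTdata : ProbabilityTheory.IndepFun T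
      (fun ω => ((x ω, y ω), fun i => (X i ω, Y i ω))) P)
    -- the predictor
    (what : Ω → EuclideanSpace ℝ (Fin d))
    (hwhat : ∀ ω, what ω = minNormEstimator (T ω) (fun i => X i ω) (fun i => Y i ω)) :
    (p + 2 ≤ n →
      MeasureTheory.Integrable (fun ω => (y ω - inner ℝ (x ω) (what ω)) ^ 2) P ∧
      ∫ ω, (y ω - inner ℝ (x ω) (what ω)) ^ 2 ∂P =
        ((1 - (p : ℝ) / d) * ‖w‖ ^ 2 + σ ^ 2) * (1 + (p : ℝ) / ((n : ℝ) - p - 1))) ∧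
    (n + 2 ≤ p →
      MeasureTheory.Integrable (fun ω => (y ω - inner ℝ (x ω) (what ω)) ^ 2) P ∧
      ∫ ω, (y ω - inner ℝ (x ω) (what ω)) ^ 2 ∂P =
        ‖w‖ ^ 2 * (1 - (n : ℝ) / d * (2 - ((d : ℝ) - n - 1) / ((p : ℝ) - n - 1))) +
          σ ^ 2 * (1 + (n : ℝ) / ((p : ℝ) - n - 1))) := by
  have hlaw := hasLaw_test_training (hasLaw_linearModel hx hε hxε hy) hcopy hiid htest
  have hd : (d : ℝ) ≠ 0 := by exact_mod_cast (by omega : d ≠ 0)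
  have hnn : ∀ S : Finset (Fin d), 0 ≤ ∑ j : {j // j ∉ S}, w j ^ 2 + σ ^ 2 :=
    fun S => by positivity
  have hF : ∀ (S : Finset (Fin d)) (q : (EuclideanSpace ℝ (Fin d) × ℝ) ×
      (Fin n → EuclideanSpace ℝ (Fin d) × ℝ)),
      0 ≤ (q.1.2 - ⟪q.1.1, sampleEstimator S q.2⟫_ℝ) ^ 2 := fun S q => sq_nonneg _
  have herr : (fun ω => (y ω - inner ℝ (x ω) (what ω)) ^ 2) = fun ω =>
      (y ω - ⟪x ω, sampleEstimator (T ω) fun i => (X i ω, Y i ω)⟫_ℝ) ^ 2 := by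
    ext ω
    rw [hwhat]
    rfl
  rw [herr]
  refine ⟨fun h => ?_, fun h => ?_⟩
  · have hpn : (p : ℝ) + 2 ≤ n := by exact_mod_cast h
    have hfrac : 0 ≤ (p : ℝ) / ((n : ℝ) - p - 1) := div_nonneg (Nat.cast_nonneg _) (by linarith)
    obtain ⟨hint, heq⟩ := integral_uniformOn_powersetCard hpd hT hlaw hTdata hF
      (R := fun S => (∑ j : {j // j ∉ S}, w j ^ 2 + σ ^ 2) * (1 + (p : ℝ) / ((n : ℝ) - p - 1)))
      (fun S _ => mul_nonneg (hnn S) (by linarith))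
      (fun S hS => aemeasurable_prediction_error w σ
        (aemeasurable_pinv_gaussianMatrix' (by simpa [hS] using h)))
      (fun S hS => lintegral_prediction_error_underparametrized w σ hS h)
    refine ⟨hint, heq.trans ?_⟩
    -- Since `τ = ‖w‖² + σ² - ∑ j ∈ S, w j ^ 2`, the risk is affine in the selected sum with these
    -- two coefficients.
    have havg := average_affine_sum_powersetCard hp hpd (fun j => w j ^ 2)
      ((‖w‖ ^ 2 + σ ^ 2) * (1 + (p : ℝ) / ((n : ℝ) - p - 1)))
      (-(1 + (p : ℝ) / ((n : ℝ) - p - 1)))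
    rw [← EuclideanSpace.real_norm_sq_eq] at havg
    simp_rw [sum_notMem_sq]
    convert havg using 1
    · congr 1
      exact Finset.sum_congr rfl fun S _ => by ring
    · ring
  · have hpn : (n : ℝ) + 2 ≤ p := by exact_mod_cast h
    have hfrac : 0 ≤ (n : ℝ) / ((p : ℝ) - n - 1) := div_nonneg (Nat.cast_nonneg _) (by linarith)
    have hfrac' : 0 ≤ 1 - (n : ℝ) / p := by
      rw [sub_nonneg]
      exact div_le_one_of_le₀ (by linarith) (Nat.cast_nonneg _)
    obtain ⟨hint, heq⟩ := integral_uniformOn_powersetCard hpd hT hlaw hTdata hF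
      (R := fun S => (∑ j : {j // j ∉ S}, w j ^ 2 + σ ^ 2) *
        (1 + (n : ℝ) / ((p : ℝ) - n - 1)) + (1 - (n : ℝ) / p) * ∑ j ∈ S, w j ^ 2)
      (fun S _ => add_nonneg (mul_nonneg (hnn S) (by linarith))
        (mul_nonneg hfrac' (Finset.sum_nonneg fun j _ => sq_nonneg _)))
      (fun S hS => aemeasurable_prediction_error w σ
        (aemeasurable_pinv_gaussianMatrix (by simpa [hS] using h)))
      (fun S hS => lintegral_prediction_error_overparametrized w σ hS h)
    refine ⟨hint, heq.trans ?_⟩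
    -- The slope now also includes the bias factor `1 - n/p`; multiplying by the average `p/d`
    -- cancels this `p` and produces the `n/d` of the formula.
    have havg := average_affine_sum_powersetCard hp hpd (fun j => w j ^ 2)
      ((‖w‖ ^ 2 + σ ^ 2) * (1 + (n : ℝ) / ((p : ℝ) - n - 1)))
      ((1 - (n : ℝ) / p) - (1 + (n : ℝ) / ((p : ℝ) - n - 1)))
    rw [← EuclideanSpace.real_norm_sq_eq] at havg
    simp_rw [sum_notMem_sq]
    have hp0 : (p : ℝ) ≠ 0 := by exact_mod_cast (by omega : p ≠ 0)
    have hpn0 : (p : ℝ) - n - 1 ≠ 0 := by linarith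
    convert havg using 1
    · congr 1
      exact Finset.sum_congr rfl fun S _ => by ring
    · field_simp
      ring
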